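/- A \emph{control function} is a non-decreasing function $\rho:\mathbb R_+\to\mathbb R_+$ with $\rho(t)\to\infty$ as $t\to\infty$. A metric space $X$ \emph{coarsely embeds into Hilbert space} if there are a Hilbert space $\mathcal H$, a map $F:X\to\mathcal H$ and control functions $\rho_\pm$ with $\rho_-(d(x,x'))\le\|F(x)-F(x')\|\le\rho_+(d(x,x'))$ for all $x,x'\in X$. A metric space $X$ has \emph{property (A)} if it has bounded geometry (for each $R$ the balls of radius $R$ have uniformly bounded finite cardinality) and for all $R,\varepsilon>0$ there are $S>0$ and $\phi:X\to\ell^2(X)$ with $\|\phi(x)\|=1$ and $\phi(x)$ supported in the ball $B_S(x)$ for all $x$, and $|1-\langle\phi(x_1),\phi(x_2)\rangle|\le\varepsilon$ whenever $d(x_1,x_2)\le R$. A \emph{coarse disjoint union} $\sqcup_n X_n$ of a sequence $(X_n)_{n\in\mathbb N}$ of metric spaces is a metric space $X$ with a map $p:X\to\mathbb N$ such that (i) $p^{-1}(n)$ is isometric to $X_n$ for every $n$; (ii) for some control function $\rho$, $|2^{p(x)}-2^{p(y)}|\le\rho(d(x,y))$ for all $x,y\in X$; (iii) for all $R>0$ and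 $n\ne m$, the set of points of $p^{-1}(n)$ at distance at most $R$ from $p^{-1}(m)$ is bounded. (It is unique up to coarse equivalence.) A \emph{proper length} on a group $G$ is a function $\ell:G\to\mathbb R_+$ with $\ell(gh)\le\ell(g)+\ell(h)$, $\ell(g^{-1})=\ell(g)$, $\ell(g)=0\iff g=e$, and $\{\ell\le R\}$ finite for every $R$. For a quotient $\pi:G\to Q$ it induces the quotient length $\ell_Q(q)=\inf\{\ell(g):\pi(g)=q\}$ and the left-invariant metric $d(q,q')=\ell_Q(q^{-1}q')$ on $Q$. A sequence of quotient groups of $G$ is \emph{faithful} if every $g\ne e$ in $G$ acts non-trivially by left translation on all but finitely many of them. \textbf{Theorem.} Let $A$ and $B$ be finitely generated residually finite groups, let $(\bar A_n)_{n\in\mathbb N}$ and $(\bar B_n)_{n\in\mathbb N}$ be faithful sequences of finite quotient groups of $A$ and $B$ respectively, and let $G_n=\bar A_n\star\bar B_n$ be their free products, regarded as quotients of $A\star B$. Fix arbitrary proper lengths on $A$, on $B$ and on $A\star B$, equip $\bar A_n$, $\bar B_n$ and $G_n$ with the induced quotient metrics, and let $\sqcup_n\bar A_n$, $\sqcup_n\bar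 B_n$, $\sqcup_n G_n$ be coarse disjoint unions of these sequences. If $\sqcup_n\bar A_n$ and $\sqcup_n\bar B_n$ coarsely embed into Hilbert space, then so does $\sqcup_n G_n$. If $\sqcup_n\bar A_n$ and $\sqcup_n\bar B_n$ have property (A), then so does $\sqcup_n G_n$. -/

import Mathlib

open Filter
open scoped NNReal

universe u

/-! ### Control functions, coarse embeddings, property (A) -/

/-- A control function: a non-decreasing function `ℝ₊ → ℝ₊` which is proper, i.e. tends to
infinity. -/
def IsControl (ρ : ℝ≥0 → ℝ≥0) : Prop :=
  Monotone ρ ∧ Tendsto ρ atTop atTop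

/-- `X` coarsely embeds into `Y`. -/
def CoarselyEmbeds (X Y : Type*) [PseudoMetricSpace X] [PseudoMetricSpace Y] : Prop :=
  ∃ (F : X → Y) (ρm ρp : ℝ≥0 → ℝ≥0), IsControl ρm ∧ IsControl ρp ∧
    ∀ x x' : X, ρm (nndist x x') ≤ nndist (F x) (F x') ∧
      nndist (F x) (F x') ≤ ρp (nndist x x')

/-- `X` coarsely embeds into some Hilbert space. Real scalars lose nothing: only the metric of the
Hilbert space matters, a complex Hilbert space is a real one by restriction of scalars, and
a real one embeds isometrically into its complexification. -/
def CoarselyEmbedsIntoHilbert (X : Type u) [PseudoMetricSpace X] : Prop :=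
  ∃ (H : Type u) (_ : NormedAddCommGroup H) (_ : InnerProductSpace ℝ H),
    CompleteSpace H ∧ CoarselyEmbeds X H

/-- Bounded geometry: balls of a given radius are finite, of uniformly bounded cardinality
(in particular the space is discrete). -/
def HasBoundedGeometry (X : Type*) [PseudoMetricSpace X] : Prop :=
  ∀ R : ℝ, ∃ K : ℕ, ∀ x : X,
    (Metric.closedBall x R).Finite ∧ (Metric.closedBall x R).ncard ≤ K

/-- Property (A), for discrete metric spaces with bounded geometry. -/
def HasPropertyA (X : Type*) [PseudoMetricSpace X] : Prop :=
  HasBoundedGeometry X ∧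
    ∀ R > (0 : ℝ), ∀ ε > (0 : ℝ), ∃ S > (0 : ℝ), ∃ φ : X → lp (fun _ : X => ℝ) 2,
      (∀ x, ‖φ x‖ = 1) ∧
      (∀ x₁ x₂, dist x₁ x₂ ≤ R → |1 - inner ℝ (φ x₁) (φ x₂)| ≤ ε) ∧
      (∀ x y, φ x y ≠ 0 → y ∈ Metric.closedBall x S)

/-! ### Coarse disjoint unions -/

/-- The "far away" distance on `ℕ`. -/
noncomputable def farAwayDist (n m : ℕ) : ℝ := |(2 : ℝ) ^ n - 2 ^ m|

/-- `Y` is (a model of) the coarse disjoint union of the sequence of metric spaces `X n`: there is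
a map `p : Y → ℕ` whose fibre over `n` is isometric to `X n`, distinct fibres get far away from
each other, and for `n ≠ m` the points of the fibre over `n` lying within a given distance of
the fibre over `m` form a bounded set. -/
def IsCoarseDisjointUnion (X : ℕ → Type*) [∀ n, MetricSpace (X n)] (Y : Type*) [MetricSpace Y] :
    Prop :=
  ∃ (p : Y → ℕ) (ρ : ℝ≥0 → ℝ≥0), IsControl ρ ∧
    (∀ n, Nonempty (X n ≃ᵢ {y : Y // p y = n})) ∧
    (∀ x y : Y, farAwayDist (p x) (p y) ≤ ρ (nndist x y)) ∧
    (∀ R : ℝ, ∀ n m : ℕ, n ≠ m →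
      Bornology.IsBounded {x : Y | p x = n ∧ ∃ y : Y, p y = m ∧ dist x y ≤ R})

/-! ### Proper lengths and quotient metrics -/

/-- A proper length function on a group. -/
structure ProperLength (G : Type*) [Group G] where
  toFun : G → ℝ
  nonneg : ∀ g, 0 ≤ toFun g
  mul_le : ∀ g h, toFun (g * h) ≤ toFun g + toFun h
  inv : ∀ g, toFun g⁻¹ = toFun g
  eq_zero_iff : ∀ g, toFun g = 0 ↔ g = 1
  proper : ∀ R : ℝ, {g | toFun g ≤ R}.Finite

instance {G : Type*} [Group G] : CoeFun (ProperLength G) (fun _ => G → ℝ) := ⟨ProperLength.toFun⟩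

section QuotientLength

variable {G Q : Type*} [Group G] [Group Q]

/-- The quotient length on a quotient `π : G → Q`: the infimum of the lengths of the lifts. -/
noncomputable def quotientLength (ℓ : ProperLength G) (π : G →* Q) (q : Q) : ℝ :=
  sInf (ℓ '' {g | π g = q})

theorem quotientLength_le (ℓ : ProperLength G) (π : G →* Q) (g : G) :
    quotientLength ℓ π (π g) ≤ ℓ g := by
  refine csInf_le ⟨0, ?_⟩ ⟨g, rfl, rfl⟩
  rintro _ ⟨h, -, rfl⟩
  exact ℓ.nonneg h

/-- The infimum defining the quotient length is attained. -/
theorem exists_quotientLength_eq (ℓ : ProperLength G) (π : G →* Q) (hπ : Function.Surjective π)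
    (q : Q) : ∃ g, π g = q ∧ ℓ g = quotientLength ℓ π q := by
  obtain ⟨g₀, hg₀⟩ := hπ q
  obtain ⟨g, ⟨hg, hgq⟩, hmin⟩ :=
    Set.exists_min_image ({g | ℓ g ≤ ℓ g₀} ∩ {g | π g = q}) ℓ
      ((ℓ.proper (ℓ g₀)).inter_of_left _) ⟨g₀, le_refl (ℓ g₀), hg₀⟩
  refine ⟨g, hgq, le_antisymm ?_ (by rw [← (hgq : π g = q)]; exact quotientLength_le ℓ π g)⟩
  refine le_csInf ⟨_, g₀, hg₀, rfl⟩ ?_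
  rintro _ ⟨h, hh, rfl⟩
  by_cases hle : ℓ h ≤ ℓ g₀
  · exact hmin h ⟨hle, hh⟩
  · exact (show ℓ g ≤ ℓ g₀ from hg).trans (not_le.mp hle).le

/-- The group `Q`, regarded as a metric space with the left-invariant metric of the quotient length
induced by `ℓ` along the surjection `π : G → Q`. -/
def LengthQuotient (_ℓ : ProperLength G) (π : G →* Q) (_hπ : Function.Surjective π) : Type _ := Q

noncomputable instance (ℓ : ProperLength G) (π : G →* Q) (hπ : Function.Surjective π) :
    MetricSpace (LengthQuotient ℓ π hπ) where
  dist x y := quotientLength ℓ π ((show Q from x)⁻¹ * (show Q from y))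
  dist_self x := by
    have h := quotientLength_le ℓ π 1
    obtain ⟨g, -, hg⟩ := exists_quotientLength_eq ℓ π hπ 1
    have h0 := ℓ.nonneg g
    rw [map_one, (ℓ.eq_zero_iff 1).2 rfl] at h
    change quotientLength ℓ π ((show Q from x)⁻¹ * (show Q from x)) = 0
    rw [inv_mul_cancel (show Q from x)]
    linarith
  dist_comm := by
    have key : ∀ x y : Q, quotientLength ℓ π (x⁻¹ * y) ≤ quotientLength ℓ π (y⁻¹ * x) := by
      intro x y
      obtain ⟨g, hg, hl⟩ := exists_quotientLength_eq ℓ π hπ (y⁻¹ * x)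
      have h := quotientLength_le ℓ π g⁻¹
      rw [map_inv, hg, ℓ.inv, hl, mul_inv_rev, inv_inv] at h
      exact h
    exact fun x y => le_antisymm (key x y) (key y x)
  dist_triangle x y z := by
    obtain ⟨g, hg, hl⟩ :=
      exists_quotientLength_eq ℓ π hπ ((show Q from x)⁻¹ * (show Q from y))
    obtain ⟨g', hg', hl'⟩ :=
      exists_quotientLength_eq ℓ π hπ ((show Q from y)⁻¹ * (show Q from z))
    have h := quotientLength_le ℓ π (g * g')
    have h2 := ℓ.mul_le g g'
    rw [map_mul, hg, hg', mul_assoc, mul_inv_cancel_left] at h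
    rw [hl, hl'] at h2
    exact h.trans h2
  eq_of_dist_eq_zero := by
    intro x y hxy
    obtain ⟨g, hg, hl⟩ :=
      exists_quotientLength_eq ℓ π hπ ((show Q from x)⁻¹ * (show Q from y))
    have h1 : g = 1 := (ℓ.eq_zero_iff g).1 (hl.trans hxy)
    rw [h1, map_one] at hg
    exact inv_mul_eq_one (G := Q).1 hg.symm

end QuotientLength

/-- The sequence of quotients `Γ ⧸ N n` is faithful: every non-trivial element of `Γ` acts
non-trivially by left translation on all but finitely many of them. -/
def IsFaithfulSeq {Γ : Type*} [Group Γ] (N : ℕ → Subgroup Γ) : Prop :=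
  ∀ g : Γ, g ≠ 1 → {n : ℕ | ∀ x : Γ ⧸ N n, g • x = x}.Finite

/-- The quotient map from the free product of `A` and `B` onto the free product of the quotients
`A ⧸ N` and `B ⧸ M`. -/
def freeProductQuotientMap {A B : Type*} [Group A] [Group B] (N : Subgroup A) (M : Subgroup B)
    [N.Normal] [M.Normal] : Monoid.Coprod A B →* Monoid.Coprod (A ⧸ N) (B ⧸ M) :=
  Monoid.Coprod.map (QuotientGroup.mk' N) (QuotientGroup.mk' M)

theorem freeProductQuotientMap_surjective {A B : Type*} [Group A] [Group B] (N : Subgroup A)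
    (M : Subgroup B) [N.Normal] [M.Normal] :
    Function.Surjective (freeProductQuotientMap N M) := by
  intro q
  induction q using Monoid.Coprod.induction_on with
  | inl a =>
    obtain ⟨a, rfl⟩ := QuotientGroup.mk'_surjective N a
    exact ⟨Monoid.Coprod.inl a, Monoid.Coprod.map_apply_inl _ _ a⟩
  | inr b =>
    obtain ⟨b, rfl⟩ := QuotientGroup.mk'_surjective M b
    exact ⟨Monoid.Coprod.inr b, Monoid.Coprod.map_apply_inr _ _ b⟩
  | mul x y hx hy =>
    obtain ⟨x, rfl⟩ := hx
    obtain ⟨y, rfl⟩ := hy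
    exact ⟨x * y, map_mul _ x y⟩

/-! The quotient metrics are left invariant. After inversion they become right invariant, and the
upper estimates concern the effect of left multiplication by a fixed element, uniformly in `n`; it
suffices to check elements of `A` and `B`, which generate. Left multiplication by a letter alters
only the first letter of a reduced word (`exists_reducedList_of_mul`), so constructions made letter
by letter inherit the estimates of the factors, whatever `n` and the length of the word. Widths are
recorded by finite subsets of the group instead of lengths, so the three proper lengths need not be
related.

Hilbert space: normalise the embeddings `f` of the factors to vanish at 1 and to keep distinct
points at distance at least 1. Each letter of a word contributes its image under `f`, in an
orthogonal summand indexed by its factor and by the suffix after it, that is, by a coset of the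
factor. Multiplication by a letter moves one coordinate only. Conversely, a squared distance of at
most `m` leaves at most `m` letters in which two words differ, all short, so their quotient is a
product of `m` elements of a finite set (`listProd_mul_inv_mem_pow`).

Property (A): it is used as averaging operators on the factors together with cutoffs around the
identity. A walker follows a word towards the empty word, crosses short letters with the probability
given by the cutoff, and otherwise stops in the current coset at a place prescribed by the averaging
operator. A change of the first letter perturbs this slightly, except that the letter may appear or
vanish, which shifts time by one step; averaging over `N` times reduces that error to order `1 / N`
(`norm_meanWalk_of_mul_sub_le`).

The passage between a coarse disjoint union and uniform statements on its fibres works because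
points of distinct fibres that are close lie in a bounded set, inside finitely many fibres
(`CoarseUnionData.cross`). -/

namespace FreeProduct

open Monoid CoprodI
open scoped Pointwise

/-! ### Reduced words -/

section Words

variable {ι : Type u} {Q : ι → Type u} [∀ i, Group (Q i)]

open Classical in
/-- Prepend a letter to a list of letters, unless it is trivial. -/
noncomputable def consLetter {i : ι} (x : Q i) (l : List (Σ i, Q i)) : List (Σ i, Q i) :=
  if x = 1 then l else ⟨i, x⟩ :: l

/-- The product of a list of letters in the free product. -/
def listProd (l : List (Σ i, Q i)) : CoprodI Q := (l.map fun s => of s.2).prod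

@[simp] theorem listProd_nil : listProd ([] : List (Σ i, Q i)) = 1 := rfl

@[simp] theorem listProd_cons (s : Σ i, Q i) (l : List (Σ i, Q i)) :
    listProd (s :: l) = of s.2 * listProd l := by simp [listProd]

open Classical in
/-- The list of letters of the reduced word representing an element of a free product. -/
noncomputable def reducedList (g : CoprodI Q) : List (Σ i, Q i) := (Word.equiv g).toList

theorem listProd_reducedList (g : CoprodI Q) : listProd (reducedList g) = g := by
  classical
  exact Word.equiv.symm_apply_apply g

theorem ne_one_of_mem_reducedList (g : CoprodI Q) : ∀ s ∈ reducedList g, s.2 ≠ 1 := by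
  classical
  exact (Word.equiv g).ne_one

/-- Left multiplication by a letter only affects the first letter of the reduced word. -/
theorem exists_reducedList_of_mul (i : ι) (g : CoprodI Q) :
    ∃ (x : Q i) (l : List (Σ i, Q i)), reducedList g = consLetter x l ∧
      ∀ a : Q i, reducedList (of a * g) = consLetter (a * x) l := by
  classical
  have key : ∀ p : Word.Pair Q i, (Word.rcons p).toList = consLetter p.head p.tail.toList := by
    intro p
    unfold Word.rcons consLetter
    split_ifs <;> rfl
  -- `equivPair` splits the word into a head in the factor `i`, possibly 1, and a tail that does not
  -- begin in that factor; `a` then acts on the head alone.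
  refine ⟨(Word.equivPair i (Word.equiv g)).head,
    (Word.equivPair i (Word.equiv g)).tail.toList, ?_, fun a => ?_⟩
  · rw [← key, ← Word.equivPair_symm, Equiv.symm_apply_apply]
    simp only [reducedList]
  · have h : Word.equiv (of a * g) = of a • Word.equiv g :=
      mul_smul (of a) g (Word.empty (M := Q))
    have : reducedList (of a * g) = (of a • Word.equiv g).toList := by
      rw [← h]; simp only [reducedList]
    rw [this, Word.of_smul_def, key]

end Words

/-! ### The Hilbert space map of a free product -/

section Hilbert

variable {ι : Type u} {Q : ι → Type u}
variable {H : Type u} [NormedAddCommGroup H]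

theorem norm_add_single_sq [InnerProductSpace ℝ H] {κ : Type*} [DecidableEq κ]
    (a : lp (fun _ : κ => H) 2) (k : κ) (x : H) (h : a k = 0) :
    ‖a + lp.single 2 k x‖ ^ 2 = ‖a‖ ^ 2 + ‖x‖ ^ 2 := by
  rw [norm_add_sq_real, lp.inner_single_right, h, inner_zero_left,
    lp.norm_single (by norm_num)]
  ring

open Classical in
/-- The sum over the letters of a word of their images, placed in orthogonal summands indexed by
the type of the letter and the part of the word that follows it. -/
noncomputable def wordMap (f : ∀ i, Q i → H) :
    List (Σ i, Q i) → lp (fun _ : ι × List (Σ i, Q i) => H) 2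
  | [] => 0
  | s :: l => wordMap f l + lp.single 2 (s.1, l) (f s.1 s.2)

variable {f : ∀ i, Q i → H}

/-- A word occupies only coordinates indexed by its proper suffixes, which are shorter than the
word. -/
theorem wordMap_apply_eq_zero (l : List (Σ i, Q i)) (i : ι) (s : List (Σ i, Q i))
    (h : l.length ≤ s.length) : wordMap f l (i, s) = 0 := by
  classical
  induction l with
  | nil => rfl
  | cons t l ih =>
    rw [List.length_cons] at h
    have hne : (i, s) ≠ (t.1, l) := by
      rintro ⟨⟩
      omega
    rw [wordMap, lp.coeFn_add, Pi.add_apply, ih (by omega), lp.single_apply,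
      Pi.single_eq_of_ne hne, add_zero]

/-- Pythagoras: the coordinate of the leading letter is vacant in `w` because of its length, and in
`v` by assumption. -/
theorem norm_wordMap_cons_sub_sq [InnerProductSpace ℝ H] (s : Σ i, Q i)
    (w v : List (Σ i, Q i))
    (h : wordMap f v (s.1, w) = 0) :
    ‖wordMap f (s :: w) - wordMap f v‖ ^ 2
      = ‖wordMap f w - wordMap f v‖ ^ 2 + ‖f s.1 s.2‖ ^ 2 := by
  classical
  rw [wordMap, add_sub_right_comm, norm_add_single_sq]
  rw [lp.coeFn_sub, Pi.sub_apply, h, wordMap_apply_eq_zero w s.1 w le_rfl, sub_zero]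

variable [∀ i, Group (Q i)]

open Classical in
theorem wordMap_consLetter (h1 : ∀ i, f i 1 = 0) {i : ι} (x : Q i) (l : List (Σ i, Q i)) :
    wordMap f (consLetter x l) = wordMap f l + lp.single 2 (i, l) (f i x) := by
  unfold consLetter
  split_ifs with h
  · rw [h, h1, lp.single_zero, add_zero]
  · rw [wordMap]

/-- Both words have the same tail `l`, so their images differ only in the coordinate `(i, l)`; a
trivial first letter does no harm as `f i 1 = 0`. -/
theorem exists_norm_wordMap_of_mul_sub (h1 : ∀ i, f i 1 = 0) (i : ι) (a : Q i) (g : CoprodI Q) :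
    ∃ x : Q i, ‖wordMap f (reducedList (of a * g)) - wordMap f (reducedList g)‖
      = ‖f i (a * x) - f i x‖ := by
  classical
  obtain ⟨x, l, hg, ha⟩ := exists_reducedList_of_mul i g
  refine ⟨x, ?_⟩
  rw [hg, ha, wordMap_consLetter h1, wordMap_consLetter h1, add_sub_add_left_eq_sub,
    ← lp.single_sub, lp.norm_single (by norm_num)]

variable [InnerProductSpace ℝ H]

/-- Words with close images in Hilbert space differ by few letters, all of them short. -/
theorem listProd_mul_inv_mem_pow (h1 : ∀ i, f i 1 = 0)
    (hsep : ∀ i (x y : Q i), x ≠ y → 1 ≤ ‖f i x - f i y‖) {S : ℝ}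
    (hS : 0 ≤ S) {T : Set (CoprodI Q)} (hT1 : 1 ∈ T)
    (hT : ∀ i (x y : Q i), ‖f i x - f i y‖ ≤ S → of (x * y⁻¹) ∈ T) (N : ℕ) :
    ∀ (w v : List (Σ i, Q i)), w.length + v.length ≤ N → (∀ s ∈ w, s.2 ≠ 1) →
      (∀ s ∈ v, s.2 ≠ 1) → ∀ m : ℕ, (m : ℝ) ≤ S ^ 2 →
      ‖wordMap f w - wordMap f v‖ ^ 2 ≤ m → listProd w * (listProd v)⁻¹ ∈ T ^ m := by
  classical
  have hmono : ∀ {m : ℕ}, 1 ∈ T ^ m := fun {m} => Set.one_mem_pow hT1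
  have sep1 : ∀ s : Σ i, Q i, s.2 ≠ 1 → 1 ≤ ‖f s.1 s.2‖ := fun s hs => by
    simpa [h1] using hsep s.1 s.2 1 hs
  have hle : ∀ {m : ℕ} {r : ℝ}, (m : ℝ) ≤ S ^ 2 → r ^ 2 ≤ m → r ≤ S := fun hm hr =>
    abs_le_of_sq_le_sq' (hr.trans hm) hS |>.2
  induction N with
  | zero =>
    intro w v hl _ _ m _ _
    have hw : w = [] := List.length_eq_zero_iff.1 (by omega)
    have hv : v = [] := List.length_eq_zero_iff.1 (by omega)
    subst hw hv
    simpa using hmono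
  | succ N ih =>
    -- The number `m` is a budget. A letter whose coordinate is vacant in the other word costs at
    -- least 1, and since `m ≤ S ^ 2` its image has norm at most `S`, which puts it in `T`.
    have strip : ∀ (s : Σ i, Q i) (w v : List (Σ i, Q i)), (s :: w).length + v.length ≤ N + 1 →
        (∀ t ∈ s :: w, t.2 ≠ 1) → (∀ t ∈ v, t.2 ≠ 1) → wordMap f v (s.1, w) = 0 →
        ∀ m : ℕ, (m : ℝ) ≤ S ^ 2 → ‖wordMap f (s :: w) - wordMap f v‖ ^ 2 ≤ m →
        ∃ k : ℕ, m = k + 1 ∧ ‖f s.1 s.2‖ ≤ S ∧ (k : ℝ) ≤ S ^ 2 ∧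
          ‖wordMap f w - wordMap f v‖ ^ 2 ≤ k := by
      intro s w v hl hw hv h0 m hm hn
      rw [norm_wordMap_cons_sub_sq s w v h0] at hn
      have hs := sep1 s (hw s List.mem_cons_self)
      have hs2 : 1 ≤ ‖f s.1 s.2‖ ^ 2 := one_le_pow₀ hs
      have hnn := sq_nonneg ‖wordMap f w - wordMap f v‖
      obtain _ | k := m
      · norm_num at hn; linarith
      · refine ⟨k, rfl, hle hm (by linarith), ?_, ?_⟩ <;> push_cast at hm hn <;> linarith
    intro w v hl hw hv m hm hn
    by_cases hA : ∃ s w', w = s :: w' ∧ wordMap f v (s.1, w') = 0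
    · obtain ⟨s, w', rfl, h0⟩ := hA
      obtain ⟨k, rfl, hs, hk, hn'⟩ := strip s w' v hl hw hv h0 m hm hn
      have := ih w' v (by rw [List.length_cons] at hl; omega)
        (fun t ht => hw t (List.mem_cons_of_mem _ ht)) hv k hk hn'
      rw [listProd_cons, mul_assoc, pow_succ']
      refine Set.mul_mem_mul ?_ this
      simpa using hT s.1 s.2 1 (by simpa [h1] using hs)
    by_cases hB : ∃ s v', v = s :: v' ∧ wordMap f w (s.1, v') = 0
    · obtain ⟨s, v', rfl, h0⟩ := hB
      rw [norm_sub_rev] at hn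
      obtain ⟨k, rfl, hs, hk, hn'⟩ := strip s v' w (by omega) hv hw h0 m hm hn
      rw [norm_sub_rev] at hn'
      have := ih w v' (by rw [List.length_cons] at hl; omega) hw
        (fun t ht => hv t (List.mem_cons_of_mem _ ht)) k hk hn'
      rw [listProd_cons, mul_inv_rev, ← mul_assoc, pow_succ]
      refine Set.mul_mem_mul this ?_
      simpa using hT s.1 1 s.2 (by simpa [h1] using hs)
    rcases w with - | ⟨s, w⟩
    · rcases v with - | ⟨t, v⟩
      · simpa using hmono
      · exact (hB ⟨t, v, rfl, wordMap_apply_eq_zero _ _ _ (by simp)⟩).elim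
    rcases v with - | ⟨t, v⟩
    · exact (hA ⟨s, w, rfl, wordMap_apply_eq_zero _ _ _ (by simp)⟩).elim
    -- If the leading coordinates differ, the one with the longer tail is vacant in the other word,
    -- whose remaining coordinates have shorter suffixes; one of the two words can then be stripped.
    have hlen : ∀ (s t : Σ i, Q i) (w v : List (Σ i, Q i)), (s.1, w) ≠ (t.1, v) →
        v.length ≤ w.length → wordMap f (t :: v) (s.1, w) = 0 := by
      intro s t w v hne hl
      rw [wordMap, lp.coeFn_add, Pi.add_apply, wordMap_apply_eq_zero _ _ _ hl, lp.single_apply,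
        Pi.single_eq_of_ne hne, add_zero]
    have heq : (s.1, w) = (t.1, v) := by
      by_contra hne
      rcases le_total v.length w.length with h | h
      · exact hA ⟨s, w, rfl, hlen s t w v hne h⟩
      · exact hB ⟨t, v, rfl, hlen t s v w (Ne.symm hne) h⟩
    -- Nothing can be stripped, so the leading coordinates coincide: the words share factor and tail
    -- and differ at most in the first letter.
    obtain ⟨i, x⟩ := s
    obtain ⟨j, y⟩ := t
    obtain ⟨rfl, rfl⟩ := Prod.mk.inj heq
    rw [wordMap, wordMap, add_sub_add_left_eq_sub, ← lp.single_sub,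
      lp.norm_single (by norm_num)] at hn
    have hprod : listProd (⟨i, x⟩ :: w) * (listProd (⟨i, y⟩ :: w))⁻¹ = of (x * y⁻¹) := by
      simp [mul_assoc]
    rw [hprod]
    by_cases hxy : x = y
    · rw [hxy, mul_inv_cancel, map_one]
      exact hmono
    · obtain _ | k := m
      · have := one_le_pow₀ (n := 2) (hsep i x y hxy)
        norm_num at hn
        simp only [hn, norm_zero] at this
        norm_num at this
      · rw [pow_succ, ← one_mul (of (x * y⁻¹))]
        exact Set.mul_mem_mul hmono (hT i x y (hle hm hn))

end Hilbert

/-! ### Averaging operators on a free product -/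

section Averaging

variable {ι : Type u} {Q : ι → Type u} [∀ i, Group (Q i)]
variable {E : Type u} [NormedAddCommGroup E] [NormedSpace ℝ E]

/-- The mean position after `t` steps of a walker that goes towards the empty word, crossing the
letter `x` with probability `c x` and otherwise stopping near it, as prescribed by `M`. -/
noncomputable def walk (c : ∀ i, Q i → ℝ) (M : ∀ i, (Q i → E) → Q i → E) (d : CoprodI Q → E) :
    ℕ → List (Σ i, Q i) → E
  | 0, l => d (listProd l)
  | _ + 1, [] => d 1
  | t + 1, s :: l => c s.1 s.2 • walk c M d t l +
      (1 - c s.1 s.2) • M s.1 (fun q => d (of q * listProd l)) s.2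

/-- The time average of the position of the walker over the first `N` steps. -/
noncomputable def meanWalk (c : ∀ i, Q i → ℝ) (M : ∀ i, (Q i → E) → Q i → E) (N : ℕ)
    (d : CoprodI Q → E) (g : CoprodI Q) : E :=
  (N : ℝ)⁻¹ • ∑ t ∈ Finset.range N, walk c M d (t + 1) (reducedList g)

variable {c : ∀ i, Q i → ℝ} {M : ∀ i, (Q i → E) → Q i → E}

/-- Each step costs one factor of `T`: crossing a letter multiplies the position on the left by its
inverse, and stopping replaces the letter by some `q` with `of (q * s.2⁻¹) ∈ T`. As `1 ∈ T`, a walk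
that stops early still fits in `T ^ t`. -/
theorem walk_mem_convexHull {T : Set (CoprodI Q)} (hT1 : 1 ∈ T)
    (hc : ∀ i x, c i x ∈ Set.Icc (0 : ℝ) 1)
    (hcT : ∀ i x, c i x ≠ 0 → of x⁻¹ ∈ T)
    (hM : ∀ i d x, M i d x ∈ convexHull ℝ (d '' {q | of (q * x⁻¹) ∈ T}))
    (d : CoprodI Q → E) (t : ℕ) : ∀ l : List (Σ i, Q i),
    walk c M d t l ∈ convexHull ℝ (d '' {g | g * (listProd l)⁻¹ ∈ T ^ t}) := by
  induction t with
  | zero =>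
    intro l
    exact subset_convexHull ℝ _ ⟨listProd l, by simp, rfl⟩
  | succ t ih =>
    rintro (- | ⟨s, l⟩)
    · exact subset_convexHull ℝ _ ⟨1, by simpa using Set.one_mem_pow hT1, rfl⟩
    · set U := convexHull ℝ (d '' {g | g * (listProd (s :: l))⁻¹ ∈ T ^ (t + 1)})
      have hrest : M s.1 (fun q => d (of q * listProd l)) s.2 ∈ U := by
        refine convexHull_mono ?_ (hM s.1 (fun q => d (of q * listProd l)) s.2)
        rintro _ ⟨q, hq, rfl⟩
        refine ⟨of q * listProd l, ?_, rfl⟩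
        have : of q * listProd l * (listProd (s :: l))⁻¹ = of (q * s.2⁻¹) := by
          simp [mul_assoc]
        rw [Set.mem_ofPred_eq, this, pow_succ, ← one_mul (of (q * s.2⁻¹))]
        exact Set.mul_mem_mul (Set.one_mem_pow hT1) hq
      rw [walk]
      by_cases h0 : c s.1 s.2 = 0
      · rw [h0, zero_smul, zero_add, sub_zero, one_smul]
        exact hrest
      · have hpass : walk c M d t l ∈ U := by
          refine convexHull_mono ?_ (ih l)
          rintro _ ⟨g, hg, rfl⟩
          refine ⟨g, ?_, rfl⟩
          rw [Set.mem_ofPred_eq, listProd_cons, mul_inv_rev, ← mul_assoc, pow_succ]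
          refine Set.mul_mem_mul hg ?_
          simpa using hcT s.1 s.2 h0
        exact (convex_convexHull ℝ _) hpass hrest (hc s.1 s.2).1
          (by linarith [(hc s.1 s.2).2]) (by ring)

theorem meanWalk_mem_convexHull {T : Set (CoprodI Q)} (hT1 : 1 ∈ T)
    (hc : ∀ i x, c i x ∈ Set.Icc (0 : ℝ) 1)
    (hcT : ∀ i x, c i x ≠ 0 → of x⁻¹ ∈ T)
    (hM : ∀ i d x, M i d x ∈ convexHull ℝ (d '' {q | of (q * x⁻¹) ∈ T}))
    {N : ℕ} (hN : N ≠ 0) (d : CoprodI Q → E) (g : CoprodI Q) :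
    meanWalk c M N d g ∈ convexHull ℝ (d '' {h | h * g⁻¹ ∈ T ^ N}) := by
  rw [meanWalk, Finset.smul_sum]
  refine (convex_convexHull ℝ _).sum_mem (fun _ _ => by positivity) ?_ fun t ht => ?_
  · simp [hN]
  · refine convexHull_mono ?_ (walk_mem_convexHull hT1 hc hcT hM d (t + 1) (reducedList g))
    rw [listProd_reducedList]
    refine Set.image_mono fun h hh => ?_
    exact Set.pow_subset_pow_right hT1 (Finset.mem_range.1 ht) hh

theorem norm_le_one_of_mem_convexHull {α : Type*} {d : α → E} (hd : ∀ a, ‖d a‖ ≤ 1) {s : Set α}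
    {x : E} (hx : x ∈ convexHull ℝ (d '' s)) : ‖x‖ ≤ 1 := by
  have : x ∈ Metric.closedBall (0 : E) 1 := by
    refine convexHull_min ?_ (convex_closedBall 0 1) hx
    rintro _ ⟨a, -, rfl⟩
    simpa using hd a
  simpa using this

/-- Only the first letter changes, from `x` to `a * x`. At each time the cutoff contributes at most
`2 * ε` and the operator `ε`. The term `4 / N` pays for the time shift when one of these letters is
trivial. -/
theorem norm_meanWalk_of_mul_sub_le
    (hc1 : ∀ i, c i 1 = 1) (hc : ∀ i x, c i x ∈ Set.Icc (0 : ℝ) 1)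
    (hM : ∀ i d x, M i d x ∈ convexHull ℝ (d '' Set.univ))
    {d : CoprodI Q → E} (hd : ∀ g, ‖d g‖ ≤ 1) (i : ι) (a : Q i) {ε : ℝ}
    (hca : ∀ x, |c i (a * x) - c i x| ≤ ε)
    (hMa : ∀ d : Q i → E, (∀ x, ‖d x‖ ≤ 1) → ∀ x, ‖M i d (a * x) - M i d x‖ ≤ ε)
    {N : ℕ} (hN : N ≠ 0) (g : CoprodI Q) :
    ‖meanWalk c M N d (of a * g) - meanWalk c M N d g‖ ≤ 3 * ε + 4 / N := by
  classical
  have hMn : ∀ i (e : Q i → E), (∀ q, ‖e q‖ ≤ 1) → ∀ x, ‖M i e x‖ ≤ 1 := fun i e he x =>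
    norm_le_one_of_mem_convexHull he (hM i e x)
  -- With `T = Set.univ` the convex hull lemma says only that the walk takes mean values of `d`.
  have hw : ∀ t l, ‖walk c M d t l‖ ≤ 1 := fun t l =>
    norm_le_one_of_mem_convexHull hd (walk_mem_convexHull (T := Set.univ) (Set.mem_univ _) hc
      (fun _ _ _ => Set.mem_univ _) (by simpa using hM) d t l)
  have hε : 0 ≤ ε := (abs_nonneg _).trans (hca 1)
  obtain ⟨x, l, hg, ha⟩ := exists_reducedList_of_mul i g
  rw [meanWalk, meanWalk, hg, ha, ← smul_sub]
  -- `V` performs a first step even when the letter is trivial; it then crosses with probability 1.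
  set V : ℕ → Q i → E := fun t x => c i x • walk c M d t l +
      (1 - c i x) • M i (fun q => d (of q * listProd l)) x with hV
  -- For a trivial letter the true walk is one step ahead of `V`, and the difference of the two sums
  -- telescopes to its end terms.
  have hshift : ∀ x : Q i, ‖∑ t ∈ Finset.range N, walk c M d (t + 1) (consLetter x l)
      - ∑ t ∈ Finset.range N, V t x‖ ≤ 2 := by
    intro x
    unfold consLetter
    split_ifs with h
    · subst h
      have : ∀ t, V t 1 = walk c M d t l := fun t => by simp [hV, hc1]
      simp only [this]
      rw [← Finset.sum_sub_distrib, Finset.sum_range_sub (fun t => walk c M d t l)]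
      exact (norm_sub_le _ _).trans (by linarith [hw N l, hw 0 l])
    · simp [walk, hV]
  have hVV : ∀ t, ‖V t (a * x) - V t x‖ ≤ 3 * ε := by
    intro t
    set m := M i (fun q => d (of q * listProd l))
    have hmn : ∀ x, ‖m x‖ ≤ 1 := hMn i _ fun q => hd _
    have : V t (a * x) - V t x = (c i (a * x) - c i x) • (walk c M d t l - m x) +
        (1 - c i (a * x)) • (m (a * x) - m x) := by
      simp only [hV]
      module
    rw [this]
    refine (norm_add_le _ _).trans ?_
    rw [norm_smul, norm_smul, Real.norm_eq_abs, Real.norm_eq_abs]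
    have h1 : ‖walk c M d t l - m x‖ ≤ 2 :=
      (norm_sub_le _ _).trans (by linarith [hw t l, hmn x])
    have h2 : |1 - c i (a * x)| ≤ 1 := by
      have := hc i (a * x)
      rw [abs_le]; constructor <;> linarith [this.1, this.2]
    have h3 : ‖m (a * x) - m x‖ ≤ ε := hMa _ (fun q => hd _) x
    have h4 := mul_le_mul (hca x) h1 (norm_nonneg _) hε
    have h5 := mul_le_mul h2 h3 (norm_nonneg _) zero_le_one
    linarith
  have hVsum : ‖∑ t ∈ Finset.range N, V t (a * x) - ∑ t ∈ Finset.range N, V t x‖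
      ≤ N * (3 * ε) := by
    rw [← Finset.sum_sub_distrib]
    refine (norm_sum_le_of_le _ fun t _ => hVV t).trans ?_
    simp
  have htot : ‖∑ t ∈ Finset.range N, walk c M d (t + 1) (consLetter (a * x) l)
      - ∑ t ∈ Finset.range N, walk c M d (t + 1) (consLetter x l)‖ ≤ 4 + N * (3 * ε) := by
    have h1 := hshift (a * x)
    have h2 := hshift x
    rw [norm_sub_rev] at h2
    have := norm_add₃_le (a := ∑ t ∈ Finset.range N, walk c M d (t + 1) (consLetter (a * x) l)
      - ∑ t ∈ Finset.range N, V t (a * x))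
      (b := ∑ t ∈ Finset.range N, V t (a * x) - ∑ t ∈ Finset.range N, V t x)
      (c := ∑ t ∈ Finset.range N, V t x
        - ∑ t ∈ Finset.range N, walk c M d (t + 1) (consLetter x l))
    rw [sub_add_sub_cancel, sub_add_sub_cancel] at this
    linarith
  have hN' : (0 : ℝ) < N := by positivity
  rw [norm_smul, norm_inv, RCLike.norm_natCast]
  calc (N : ℝ)⁻¹ * _ ≤ (N : ℝ)⁻¹ * (4 + N * (3 * ε)) := by gcongr
    _ = 3 * ε + 4 / N := by field_simp; ring

end Averaging

/-! ### The binary free product -/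

section Binary

variable (A B : Type u) [Group A] [Group B]

/-- Two groups, as a family indexed by a two-element type. -/
def pair : ULift.{u} Bool → Type u := fun b => cond b.down A B

instance : ∀ b, Group (pair A B b)
  | ⟨true⟩ => inferInstanceAs (Group A)
  | ⟨false⟩ => inferInstanceAs (Group B)

variable {A B}

/-- A function on both members of a pair of groups. -/
def pairRec {C : ULift.{u} Bool → Sort*} (f : C ⟨true⟩) (g : C ⟨false⟩) : ∀ b, C b
  | ⟨true⟩ => f
  | ⟨false⟩ => g

/-- The letters of the first group. -/
def ofLeft : A →* CoprodI (pair A B) := of (M := pair A B) (i := ⟨true⟩)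

/-- The letters of the second group. -/
def ofRight : B →* CoprodI (pair A B) := of (M := pair A B) (i := ⟨false⟩)

variable (A B) in
/-- The binary free product as an indexed free product. -/
def coprodEquiv : Coprod A B ≃* CoprodI (pair A B) :=
  MonoidHom.toMulEquiv (Coprod.lift ofLeft ofRight)
    (lift (pairRec (C := fun b => pair A B b →* Coprod A B) Coprod.inl Coprod.inr))
    (by
      refine Coprod.hom_ext ?_ ?_
      · ext x
        exact (congrArg _ (Coprod.lift_apply_inl (ofLeft (A := A) (B := B)) ofRight x)).trans
          (lift_of (pairRec (C := fun b => pair A B b →* Coprod A B) Coprod.inl Coprod.inr)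
            (i := ⟨true⟩) x)
      · ext x
        exact (congrArg _ (Coprod.lift_apply_inr (ofLeft (A := A) (B := B)) ofRight x)).trans
          (lift_of (pairRec (C := fun b => pair A B b →* Coprod A B) Coprod.inl Coprod.inr)
            (i := ⟨false⟩) x))
    (by
      refine ext_hom _ _ fun b => ?_
      obtain ⟨_ | _⟩ := b
      · ext x
        simp only [MonoidHom.comp_apply, lift_of]
        exact Coprod.lift_apply_inr _ _ _
      · ext x
        simp only [MonoidHom.comp_apply, lift_of]
        exact Coprod.lift_apply_inl _ _ _)

theorem coprodEquiv_inl (a : A) :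
    coprodEquiv A B (Coprod.inl a) = of (M := pair A B) (i := ⟨true⟩) a :=
  Coprod.lift_apply_inl ofLeft ofRight a

theorem coprodEquiv_inr (b : B) :
    coprodEquiv A B (Coprod.inr b) = of (M := pair A B) (i := ⟨false⟩) b :=
  Coprod.lift_apply_inr ofLeft ofRight b

end Binary

end FreeProduct

/-! ### Coarse embeddings -/

theorem CoarselyEmbeds.of_bounds {X Y : Type*} [PseudoMetricSpace X] [PseudoMetricSpace Y]
    (F : X → Y) (h₁ : ∀ R : ℝ, ∃ S : ℝ, ∀ x y, dist x y ≤ R → dist (F x) (F y) ≤ S)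
    (h₂ : ∀ S : ℝ, ∃ R : ℝ, ∀ x y, dist (F x) (F y) ≤ S → dist x y ≤ R) :
    CoarselyEmbeds X Y := by
  set P : ℝ≥0 → Set ℝ≥0 := fun t => {s | ∃ x y, nndist x y ≤ t ∧ nndist (F x) (F y) = s}
  -- Inserting `t` keeps the lower control function proper when no points are that far apart, as the
  -- infimum of the empty set is 0. The summand `t` in the upper one also forces properness.
  set M : ℝ≥0 → Set ℝ≥0 := fun t => insert t {s | ∃ x y, t ≤ nndist x y ∧ nndist (F x) (F y) = s}
   
  have hPb : ∀ t, BddAbove (P t) := by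
    intro t
    obtain ⟨S, hS⟩ := h₁ t
    refine ⟨S.toNNReal, ?_⟩
    rintro _ ⟨x, y, hxy, rfl⟩
    exact NNReal.le_toNNReal_of_coe_le (hS x y hxy)
  have hP0 : ∀ t, 0 ≤ sSup (P t) := fun t => zero_le
  refine ⟨F, fun t => sInf (M t), fun t => sSup (P t) + t, ⟨?_, ?_⟩, ⟨?_, ?_⟩, fun x y => ⟨?_, ?_⟩⟩
  · intro s t hst
    refine le_csInf ⟨t, Set.mem_insert _ _⟩ ?_
    rintro _ (rfl | ⟨x, y, hxy, rfl⟩)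
    · exact (csInf_le' (Set.mem_insert _ _)).trans hst
    · exact csInf_le' (Or.inr ⟨x, y, hst.trans hxy, rfl⟩)
  · refine tendsto_atTop.2 fun b => ?_
    obtain ⟨R, hR⟩ := h₂ b
    filter_upwards [eventually_gt_atTop R.toNNReal, eventually_ge_atTop b] with t ht htb
    refine le_csInf ⟨t, Set.mem_insert _ _⟩ ?_
    rintro _ (rfl | ⟨x, y, hxy, rfl⟩)
    · exact htb
    · by_contra! hlt
      have h := hR x y (NNReal.coe_le_coe.2 hlt.le)
      have : nndist x y ≤ R.toNNReal := NNReal.le_toNNReal_of_coe_le h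
      exact absurd (hxy.trans this) (not_le.2 ht)
  · intro s t hst
    refine add_le_add ?_ hst
    rcases (P s).eq_empty_or_nonempty with h | h
    · rw [h, csSup_empty]; exact zero_le
    · refine csSup_le_csSup (hPb t) h ?_
      rintro _ ⟨x, y, hxy, rfl⟩
      exact ⟨x, y, hxy.trans hst, rfl⟩
  · exact tendsto_atTop_mono (fun t => le_add_of_nonneg_left (hP0 t)) tendsto_id
  · exact csInf_le' (Or.inr ⟨x, y, le_rfl, rfl⟩)
  · exact (le_csSup (hPb _) ⟨x, y, le_rfl, rfl⟩).trans (le_add_of_nonneg_right zero_le)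

theorem CoarselyEmbeds.exists_bounds {X Y : Type*} [PseudoMetricSpace X] [PseudoMetricSpace Y]
    (h : CoarselyEmbeds X Y) : ∃ F : X → Y,
      (∀ R : ℝ, ∃ S : ℝ, ∀ x y, dist x y ≤ R → dist (F x) (F y) ≤ S) ∧
      (∀ S : ℝ, ∃ R : ℝ, ∀ x y, dist (F x) (F y) ≤ S → dist x y ≤ R) := by
  obtain ⟨F, ρm, ρp, ⟨-, hm⟩, ⟨hp, -⟩, h⟩ := h
  refine ⟨F, fun R => ⟨ρp R.toNNReal, fun x y hxy => ?_⟩, fun S => ?_⟩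
  · have := (h x y).2.trans (hp (NNReal.le_toNNReal_of_coe_le hxy))
    exact_mod_cast this
  · obtain ⟨R, hR⟩ := (tendsto_atTop.1 hm (S.toNNReal + 1)).exists_forall_of_atTop
    refine ⟨R, fun x y hxy => ?_⟩
    by_contra! hlt
    have h1 := hR (nndist x y) (by exact_mod_cast hlt.le)
    have h2 := (h1.trans (h x y).1).trans (NNReal.le_toNNReal_of_coe_le hxy)
    exact absurd h2 (not_le.2 (lt_add_one _))

/-! ### Distances in the `ℓ²` sum of two spaces. -/

section ProdL2

variable {H K : Type*} [SeminormedAddCommGroup H] [SeminormedAddCommGroup K] (a b : H) (c d : K)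

theorem norm_toLp_sub_sq : ‖WithLp.toLp 2 (a, c) - WithLp.toLp 2 (b, d)‖ ^ 2
    = ‖a - b‖ ^ 2 + ‖c - d‖ ^ 2 :=
  WithLp.prod_norm_sq_eq_of_L2 (WithLp.toLp 2 (a, c) - WithLp.toLp 2 (b, d))

theorem norm_fst_sub_le : ‖a - b‖ ≤ ‖WithLp.toLp 2 (a, c) - WithLp.toLp 2 (b, d)‖ := by
  have h := norm_toLp_sub_sq a b c d
  exact abs_le_of_sq_le_sq' (by nlinarith [sq_nonneg ‖c - d‖]) (norm_nonneg _) |>.2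

theorem norm_snd_sub_le : ‖c - d‖ ≤ ‖WithLp.toLp 2 (a, c) - WithLp.toLp 2 (b, d)‖ := by
  have h := norm_toLp_sub_sq a b c d
  exact abs_le_of_sq_le_sq' (by nlinarith [sq_nonneg ‖a - b‖]) (norm_nonneg _) |>.2

theorem norm_toLp_sub_le :
    ‖WithLp.toLp 2 (a, c) - WithLp.toLp 2 (b, d)‖ ≤ ‖a - b‖ + ‖c - d‖ := by
  have h := norm_toLp_sub_sq a b c d
  refine abs_le_of_sq_le_sq' ?_ (by positivity) |>.2
  nlinarith [norm_nonneg (a - b), norm_nonneg (c - d)]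

end ProdL2

/-- A coarsely embeddable space has a coarse embedding that separates points uniformly. -/
theorem CoarselyEmbedsIntoHilbert.exists_separated {X : Type u} [PseudoMetricSpace X]
    (h : CoarselyEmbedsIntoHilbert X) :
    ∃ (H : Type u) (_ : NormedAddCommGroup H) (_ : InnerProductSpace ℝ H) (_ : CompleteSpace H)
      (F : X → H), (∀ R : ℝ, ∃ S : ℝ, ∀ x y, dist x y ≤ R → ‖F x - F y‖ ≤ S) ∧
      (∀ S : ℝ, ∃ R : ℝ, ∀ x y, ‖F x - F y‖ ≤ S → dist x y ≤ R) ∧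
      ∀ x y, x ≠ y → 1 ≤ ‖F x - F y‖ := by
  classical
  obtain ⟨H, _, _, _, hH⟩ := h
  obtain ⟨F, h₁, h₂⟩ := hH.exists_bounds
  simp only [dist_eq_norm] at h₁ h₂
  -- An orthonormal family adds a bounded amount to all distances and separates distinct points.
  set δ : X → lp (fun _ : X => ℝ) 2 := fun x => lp.single 2 x 1 with hδ
  have hδn : ∀ x, ‖δ x‖ = 1 := fun x => by
    rw [hδ]; simp only; rw [lp.norm_single (by norm_num), norm_one]
  set G : X → WithLp 2 (H × lp (fun _ : X => ℝ) 2) := fun x => WithLp.toLp 2 (F x, δ x)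
  have hfst : ∀ x y, ‖F x - F y‖ ≤ ‖G x - G y‖ := fun x y => norm_fst_sub_le _ _ _ _
  have hsnd : ∀ x y, ‖δ x - δ y‖ ≤ ‖G x - G y‖ := fun x y => norm_snd_sub_le _ _ _ _
  have hle : ∀ x y, ‖G x - G y‖ ≤ ‖F x - F y‖ + ‖δ x - δ y‖ := fun x y =>
    norm_toLp_sub_le _ _ _ _
  refine ⟨WithLp 2 (H × lp (fun _ : X => ℝ) 2), inferInstance, inferInstance, inferInstance, G,
    fun R => ?_, fun S => ?_, fun x y hxy => ?_⟩
  · obtain ⟨S, hS⟩ := h₁ R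
    refine ⟨S + 2, fun x y hxy => (hle x y).trans (add_le_add (hS x y hxy) ?_)⟩
    exact (norm_sub_le _ _).trans (by rw [hδn, hδn]; norm_num)
  · obtain ⟨R, hR⟩ := h₂ S
    exact ⟨R, fun x y hxy => hR x y ((hfst x y).trans hxy)⟩
  · refine le_trans ?_ (hsnd x y)
    have := lp.norm_apply_le_norm (p := 2) (by norm_num) (δ x - δ y) x
    rw [lp.coeFn_sub, Pi.sub_apply, hδ] at this
    simp only [lp.single_apply, Pi.single_eq_same, Pi.single_eq_of_ne hxy, sub_zero,
      norm_one] at this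
    exact this

/-! ### Coarse disjoint unions -/

/-- The structure of a coarse disjoint union: the inclusions of the fibres, and for each distance
a bounded set, inside finitely many fibres, that contains the points which are that close to
another fibre. -/
structure CoarseUnionData (X : ℕ → Type*) [∀ n, MetricSpace (X n)] (Y : Type*) [MetricSpace Y] where
  p : Y → ℕ
  q : ∀ n, X n → Y
  isometry : ∀ n, Isometry (q n)
  p_q : ∀ n x, p (q n x) = n
  exists_q : ∀ y, ∃ n x, q n x = y
  cross : ∀ R : ℝ, ∃ (N : ℕ) (E : Set Y), Bornology.IsBounded E ∧
    ∀ x y, p x ≠ p y → dist x y ≤ R → x ∈ E ∧ p x < N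

/-- Two distinct powers of 2 differ by at least half of the larger one. -/
theorem lt_of_farAwayDist_le {n m : ℕ} (hnm : n ≠ m) {S : ℝ} (h : farAwayDist n m ≤ S) :
    n < ⌈2 * S⌉₊ := by
  have key : (2 : ℝ) ^ n ≤ 2 * S := by
    rw [farAwayDist, abs_le] at h
    rcases lt_or_gt_of_ne hnm with hlt | hlt
    · have : (2 : ℝ) ^ (n + 1) ≤ 2 ^ m := pow_le_pow_right₀ (by norm_num) hlt
      rw [pow_succ] at this
      have : (0 : ℝ) < 2 ^ n := by positivity
      linarith [h.1]
    · have : (2 : ℝ) ^ (m + 1) ≤ 2 ^ n := pow_le_pow_right₀ (by norm_num) hlt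
      rw [pow_succ] at this
      linarith [h.2]
  have h1 : (n : ℝ) < 2 ^ n := by exact_mod_cast Nat.lt_two_pow_self
  exact Nat.lt_ceil.2 (h1.trans_le key)

theorem farAwayDist_comm (n m : ℕ) : farAwayDist n m = farAwayDist m n := abs_sub_comm _ _

theorem IsCoarseDisjointUnion.nonempty_data {X : ℕ → Type*} [∀ n, MetricSpace (X n)] {Y : Type*}
    [MetricSpace Y] (h : IsCoarseDisjointUnion X Y) : Nonempty (CoarseUnionData X Y) := by
  obtain ⟨p, ρ, ⟨hρ, -⟩, he, hfar, hb⟩ := h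
  refine ⟨⟨p, fun n x => ((he n).some x : Y), fun n => isometry_subtype_coe.comp (he n).some.isometry,
    fun n x => ((he n).some x).2, fun y => ⟨p y, (he (p y)).some.symm ⟨y, rfl⟩, by simp⟩,
    fun R => ?_⟩⟩
  set N := ⌈2 * (ρ R.toNNReal : ℝ)⌉₊
  refine ⟨N, ⋃ n ∈ Finset.range N, ⋃ m ∈ Finset.range N,
    {x | n ≠ m ∧ p x = n ∧ ∃ y : Y, p y = m ∧ dist x y ≤ R}, ?_, fun x y hp hxy => ?_⟩
  · refine (Bornology.isBounded_biUnion_finset _).2 fun n _ =>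
      (Bornology.isBounded_biUnion_finset _).2 fun m _ => ?_
    by_cases hnm : n = m
    · simp [hnm]
    · exact (hb R n m hnm).subset fun x hx => hx.2
  · have h : farAwayDist (p x) (p y) ≤ ρ R.toNNReal :=
      (hfar x y).trans (NNReal.coe_le_coe.2 (hρ (NNReal.le_toNNReal_of_coe_le hxy)))
    have hx : p x < N := lt_of_farAwayDist_le hp h
    have hy : p y < N := lt_of_farAwayDist_le (Ne.symm hp) (by rwa [farAwayDist_comm])
    refine ⟨?_, hx⟩
    simp only [Set.mem_iUnion, Finset.mem_range]
    exact ⟨p x, hx, p y, hy, hp, rfl, y, rfl, hxy⟩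

namespace CoarseUnionData

variable {X : ℕ → Type*} [∀ n, MetricSpace (X n)] {Y : Type*} [MetricSpace Y]
  (D : CoarseUnionData X Y)

/-- A family of maps on the fibres extends to the union. -/
theorem exists_extend {C : Type*} (G : ∀ n, X n → C) : ∃ Φ : Y → C, ∀ n x, Φ (D.q n x) = G n x := by
  choose n x h using D.exists_q
  refine ⟨fun y => G (n y) (x y), fun k z => ?_⟩
  have hk : ∀ (j : ℕ) (w : X j), D.q j w = D.q k z → G j w = G k z := by
    intro j w hjw
    have : j = k := by rw [← D.p_q j w, hjw, D.p_q]
    subst this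
    rw [(D.isometry j).injective hjw]
  exact hk _ _ (h _)

theorem isBounded_of_fibers {E : Set Y} (N : ℕ) (hN : ∀ y ∈ E, D.p y < N)
    (h : ∀ n, ∃ R : ℝ, ∀ x x', D.q n x ∈ E → D.q n x' ∈ E → dist x x' ≤ R) :
    Bornology.IsBounded E := by
  have : E ⊆ ⋃ n ∈ Finset.range N, {y ∈ E | D.p y = n} := by
    intro y hy
    simpa [hy] using hN y hy
  refine Bornology.IsBounded.subset ?_ this
  refine (Bornology.isBounded_biUnion_finset _).2 fun n _ => ?_
  obtain ⟨R, hR⟩ := h n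
  refine Metric.isBounded_iff.2 ⟨R, ?_⟩
  rintro y ⟨hy, hyn⟩ z ⟨hz, hzn⟩
  obtain ⟨k, x, rfl⟩ := D.exists_q y
  obtain ⟨l, x', rfl⟩ := D.exists_q z
  rw [D.p_q] at hyn hzn
  subst hyn hzn
  rw [(D.isometry _).dist_eq]
  exact hR x x' hy hz

end CoarseUnionData

/-- The fibres are mapped to orthogonal summands, with an extra real coordinate `2 ^ p`. Close
points of distinct fibres lie in a bounded set within finitely many fibres, where the map is
bounded. Conversely, if points of distinct fibres have close images, the extra coordinate bounds
their indices and orthogonality bounds the norms of their images, which confines them to a bounded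
set. -/
theorem IsCoarseDisjointUnion.coarselyEmbedsIntoHilbert {X : ℕ → Type u} [∀ n, MetricSpace (X n)]
    {Y : Type u} [MetricSpace Y] (hY : IsCoarseDisjointUnion X Y)
    {E : ℕ → Type u} [∀ n, NormedAddCommGroup (E n)] [∀ n, InnerProductSpace ℝ (E n)]
    [∀ n, CompleteSpace (E n)] (F : ∀ n, X n → E n)
    (h₁ : ∀ R : ℝ, ∃ S : ℝ, ∀ n x y, dist x y ≤ R → ‖F n x - F n y‖ ≤ S)
    (h₂ : ∀ S : ℝ, ∃ R : ℝ, ∀ n x y, ‖F n x - F n y‖ ≤ S → dist x y ≤ R) :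
    CoarselyEmbedsIntoHilbert Y := by
  obtain ⟨D⟩ := hY.nonempty_data
  obtain ⟨Φ, hΦ⟩ := D.exists_extend fun n x => lp.single (E := E) 2 n (F n x)
  set G : Y → WithLp 2 (lp E 2 × ℝ) := fun y => WithLp.toLp 2 (Φ y, 2 ^ D.p y)
  have hfst : ∀ x y, ‖Φ x - Φ y‖ ≤ ‖G x - G y‖ := fun x y => norm_fst_sub_le _ _ _ _
  have hsnd : ∀ x y, farAwayDist (D.p x) (D.p y) ≤ ‖G x - G y‖ := fun x y =>
    norm_snd_sub_le (Φ x) (Φ y) ((2 : ℝ) ^ D.p x) (2 ^ D.p y)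
  have hle : ∀ x y, ‖G x - G y‖ ≤ ‖Φ x - Φ y‖ + farAwayDist (D.p x) (D.p y) := fun x y =>
    norm_toLp_sub_le _ _ _ _
  have hfib : ∀ n x x', ‖Φ (D.q n x) - Φ (D.q n x')‖ = ‖F n x - F n x'‖ := fun n x x' => by
    rw [hΦ, hΦ, ← lp.single_sub, lp.norm_single (by norm_num)]
  have hΦn : ∀ n x, ‖Φ (D.q n x)‖ = ‖F n x‖ := fun n x => by
    rw [hΦ, lp.norm_single (by norm_num)]
  refine ⟨WithLp 2 (lp E 2 × ℝ), inferInstance, inferInstance, inferInstance,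
    CoarselyEmbeds.of_bounds G (fun R => ?_) fun S => ?_⟩
  · obtain ⟨S, hS⟩ := h₁ R
    obtain ⟨N, U, hU, hcross⟩ := D.cross R
    have hbd : ∀ n, ∃ C, ∀ x, D.q n x ∈ U → ‖Φ (D.q n x)‖ ≤ C := by
      intro n
      by_cases hx : ∃ x, D.q n x ∈ U
      · obtain ⟨x, hx⟩ := hx
        obtain ⟨r, hr⟩ := Metric.isBounded_iff.1 hU
        obtain ⟨S', hS'⟩ := h₁ r
        refine ⟨S' + ‖F n x‖, fun z hz => ?_⟩
        have := hS' n z x (by rw [← (D.isometry n).dist_eq]; exact hr hz hx)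
        rw [hΦn]
        linarith [norm_sub_norm_le (F n z) (F n x)]
      · exact ⟨0, fun x h => (hx ⟨x, h⟩).elim⟩
    choose C hC using hbd
    obtain ⟨C', hC'⟩ := ((Finset.range N).image C).exists_le
    have hC'' : ∀ y ∈ U, D.p y < N → ‖Φ y‖ ≤ C' := by
      intro y hy hyN
      obtain ⟨n, x, rfl⟩ := D.exists_q y
      rw [D.p_q] at hyN
      exact (hC n x hy).trans
        (hC' _ (Finset.mem_image_of_mem _ (Finset.mem_range.2 hyN)))
    refine ⟨max S (C' + C' + 2 ^ N), fun x y hxy => ?_⟩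
    rw [dist_eq_norm]
    by_cases hp : D.p x = D.p y
    · refine le_max_of_le_left ?_
      obtain ⟨n, x, rfl⟩ := D.exists_q x
      obtain ⟨m, y, rfl⟩ := D.exists_q y
      rw [D.p_q, D.p_q] at hp
      subst hp
      refine (hle _ _).trans ?_
      rw [hfib, D.p_q, D.p_q, farAwayDist, sub_self, abs_zero, add_zero]
      exact hS n x y (by rwa [(D.isometry n).dist_eq] at hxy)
    · refine le_max_of_le_right ?_
      obtain ⟨hxU, hxN⟩ := hcross x y hp hxy
      obtain ⟨hyU, hyN⟩ := hcross y x (Ne.symm hp) (by rwa [dist_comm])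
      refine (hle _ _).trans (add_le_add ((norm_sub_le _ _).trans
        (add_le_add (hC'' x hxU hxN) (hC'' y hyU hyN))) ?_)
      have hx2 : (2 : ℝ) ^ D.p x ≤ 2 ^ N := pow_le_pow_right₀ (by norm_num) hxN.le
      have hy2 : (2 : ℝ) ^ D.p y ≤ 2 ^ N := pow_le_pow_right₀ (by norm_num) hyN.le
      have hx0 : (0 : ℝ) < 2 ^ D.p x := by positivity
      have hy0 : (0 : ℝ) < 2 ^ D.p y := by positivity
      rw [farAwayDist, abs_le]
      constructor <;> linarith
  · obtain ⟨R, hR⟩ := h₂ S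
    have hU : Bornology.IsBounded {y | ‖Φ y‖ ≤ S ∧ D.p y < ⌈2 * S⌉₊} := by
      refine D.isBounded_of_fibers ⌈2 * S⌉₊ (fun y hy => hy.2) fun n => ?_
      -- Two points of one fibre with images of norm at most `S` have images at distance at most `S
      -- + S`.
      obtain ⟨R', hR'⟩ := h₂ (S + S)
      refine ⟨R', fun x x' hx hx' => hR' n x x' ((norm_sub_le _ _).trans ?_)⟩
      rw [← hΦn, ← hΦn]
      exact add_le_add hx.1 hx'.1
    obtain ⟨R', hR'⟩ := Metric.isBounded_iff.1 hU
    have hnorm : ∀ x y, D.p x ≠ D.p y → ‖Φ x‖ ≤ ‖Φ x - Φ y‖ := by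
      intro x y hp
      obtain ⟨n, x, rfl⟩ := D.exists_q x
      obtain ⟨m, y, rfl⟩ := D.exists_q y
      rw [D.p_q, D.p_q] at hp
      have := lp.norm_apply_le_norm (p := 2) (by norm_num) (Φ (D.q n x) - Φ (D.q m y)) n
      have h0 : (lp.single (E := E) 2 m (F m y)) n = 0 := lp.single_apply_ne _ _ _ hp
      have h1 : (Φ (D.q n x) - Φ (D.q m y)) n = F n x := by
        rw [lp.coeFn_sub, Pi.sub_apply, hΦ m y, h0, hΦ n x, lp.single_apply_self, sub_zero]
      rwa [hΦn, ← h1]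
    refine ⟨max R R', fun x y hxy => ?_⟩
    rw [dist_eq_norm] at hxy
    by_cases hp : D.p x = D.p y
    · refine le_max_of_le_left ?_
      obtain ⟨n, x, rfl⟩ := D.exists_q x
      obtain ⟨m, y, rfl⟩ := D.exists_q y
      rw [D.p_q, D.p_q] at hp
      subst hp
      rw [(D.isometry n).dist_eq]
      refine hR n x y ?_
      rw [← hfib]
      exact (hfst _ _).trans hxy
    · refine le_max_of_le_right (hR' ⟨?_, ?_⟩ ⟨?_, ?_⟩)
      · exact (hnorm x y hp).trans ((hfst _ _).trans hxy)
      · exact lt_of_farAwayDist_le hp ((hsnd _ _).trans hxy)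
      · refine (hnorm y x (Ne.symm hp)).trans ?_
        rw [norm_sub_rev]
        exact (hfst _ _).trans hxy
      · refine lt_of_farAwayDist_le (Ne.symm hp) ?_
        rw [farAwayDist_comm]
        exact (hsnd _ _).trans hxy

/-! ### Property (A) -/

section PropertyA

/-- The point masses in `ℓ¹`. -/
noncomputable def pointMass {X : Type*} (x : X) : lp (fun _ : X => ℝ) 1 :=
  open Classical in lp.single 1 x (1 : ℝ)

theorem norm_pointMass {X : Type*} (x : X) : ‖pointMass x‖ = 1 := by
  classical
  rw [pointMass, lp.norm_single (by norm_num), norm_one]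

theorem hasSum_abs_lp_one {X : Type*} (f : lp (fun _ : X => ℝ) 1) : HasSum (fun y => |f y|) ‖f‖ := by
  have := lp.hasSum_norm (p := 1) (by norm_num) f
  simpa using this

theorem hasSum_sq_lp_two {X : Type*} (f : lp (fun _ : X => ℝ) 2) :
    HasSum (fun y => f y ^ 2) (‖f‖ ^ 2) := by
  have := lp.hasSum_norm (p := 2) (by norm_num) f
  simpa using this

/-- An element of the convex hull of the point masses of a set is a probability measure supported
by that set. -/
theorem of_mem_convexHull_pointMass {X : Type*} {s : Set X} {f : lp (fun _ : X => ℝ) 1}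
    (hf : f ∈ convexHull ℝ (pointMass '' s)) :
    (∀ y, 0 ≤ f y) ∧ (∀ y, f y ≠ 0 → y ∈ s) ∧ HasSum (fun y => f y) 1 := by
  classical
  have hconv : Convex ℝ {f : lp (fun _ : X => ℝ) 1 |
      (∀ y, 0 ≤ f y) ∧ (∀ y, f y ≠ 0 → y ∈ s) ∧ HasSum (fun y => f y) 1} := by
    rintro f ⟨hf0, hfs, hf1⟩ g ⟨hg0, hgs, hg1⟩ a b ha hb hab
    refine ⟨fun y => ?_, fun y hy => ?_, ?_⟩
    · have := hf0 y
      have := hg0 y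
      change 0 ≤ a * f y + b * g y
      positivity
    · by_contra hys
      have h1 : f y = 0 := by by_contra h; exact hys (hfs y h)
      have h2 : g y = 0 := by by_contra h; exact hys (hgs y h)
      apply hy
      change a * f y + b * g y = 0
      rw [h1, h2]; simp
    · have := (hf1.mul_left a).add (hg1.mul_left b)
      rw [mul_one, mul_one, hab] at this
      exact this
  refine convexHull_min ?_ hconv hf
  rintro _ ⟨x, hx, rfl⟩
  refine ⟨fun y => ?_, fun y hy => ?_, ?_⟩
  · rw [pointMass, lp.single_apply]
    exact (Pi.single_nonneg (i := x) (α := fun _ => ℝ)).2 zero_le_one y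
  · by_cases hyx : y = x
    · rwa [hyx]
    · rw [pointMass, lp.single_apply, Pi.single_eq_of_ne hyx] at hy
      exact (hy rfl).elim
  · have := hasSum_single (f := fun y => (pointMass x) y) x fun y hy => by
      rw [pointMass, lp.single_apply, Pi.single_eq_of_ne hy]
    convert this
    rw [pointMass, lp.single_apply_self]

/-- Property (A) in terms of probability measures. -/
theorem HasPropertyA.of_convexHull {X : Type*} [PseudoMetricSpace X] (hX : HasBoundedGeometry X)
    (h : ∀ R > (0 : ℝ), ∀ ε > (0 : ℝ), ∃ S : ℝ, ∃ ζ : X → lp (fun _ : X => ℝ) 1,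
      (∀ x, ζ x ∈ convexHull ℝ (pointMass '' Metric.closedBall x S)) ∧
      ∀ x y, dist x y ≤ R → ‖ζ x - ζ y‖ ≤ ε) : HasPropertyA X := by
  refine ⟨hX, fun R hR ε hε => ?_⟩
  obtain ⟨S, ζ, hζ, hclose⟩ := h R hR ε hε
  have h0 := fun x => (of_mem_convexHull_pointMass (hζ x)).1
  have hs := fun x => (of_mem_convexHull_pointMass (hζ x)).2.1
  have h1 := fun x => (of_mem_convexHull_pointMass (hζ x)).2.2
  -- Square roots of probability densities are unit vectors of `ℓ²` with the same support, and `(√a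
  -- - √b) ^ 2 ≤ |a - b|` bounds their distance.
  set φ : X → lp (fun _ : X => ℝ) 2 := fun x => ⟨fun y => √(ζ x y), memℓp_gen (by
    have : (fun y => ‖√(ζ x y)‖ ^ (2 : ENNReal).toReal) = fun y => ζ x y := by
      ext y
      simp [Real.sq_sqrt (h0 x y)]
    rw [this]
    exact (h1 x).summable)⟩
  have hφa : ∀ x y, φ x y = √(ζ x y) := fun x y => rfl
  have hnorm : ∀ x, ‖φ x‖ = 1 := by
    intro x
    have h2 : HasSum (fun y => φ x y ^ 2) 1 := by
      simp only [hφa, Real.sq_sqrt (h0 x _)]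
      exact h1 x
    have := (hasSum_sq_lp_two (φ x)).unique h2
    nlinarith [norm_nonneg (φ x)]
  refine ⟨max S 1, by positivity, φ, hnorm, fun x₁ x₂ hx => ?_, fun x y hy => ?_⟩
  · have hle : ‖φ x₁ - φ x₂‖ ^ 2 ≤ ‖ζ x₁ - ζ x₂‖ := by
      refine hasSum_le (fun y => ?_) (hasSum_sq_lp_two (φ x₁ - φ x₂))
        (hasSum_abs_lp_one (ζ x₁ - ζ x₂))
      rw [lp.coeFn_sub, Pi.sub_apply, lp.coeFn_sub, Pi.sub_apply, hφa, hφa]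
      have ha := Real.sq_sqrt (h0 x₁ y)
      have hb := Real.sq_sqrt (h0 x₂ y)
      have ha0 := Real.sqrt_nonneg (ζ x₁ y)
      have hb0 := Real.sqrt_nonneg (ζ x₂ y)
      set a := √(ζ x₁ y)
      set b := √(ζ x₂ y)
      rw [← ha, ← hb, sq_sub_sq, abs_mul, abs_of_nonneg (add_nonneg ha0 hb0), ← sq_abs (a - b), sq]
      refine mul_le_mul_of_nonneg_right ?_ (abs_nonneg _)
      rw [abs_le]; constructor <;> linarith
    have hin : 1 - inner ℝ (φ x₁) (φ x₂) = ‖φ x₁ - φ x₂‖ ^ 2 / 2 := by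
      rw [norm_sub_sq_real, hnorm, hnorm]; ring
    rw [hin, abs_of_nonneg (by positivity)]
    have := hclose x₁ x₂ hx
    have := norm_nonneg (ζ x₁ - ζ x₂)
    linarith
  · refine Metric.closedBall_subset_closedBall (le_max_left _ _) (hs x y fun h => hy ?_)
    rw [hφa, h, Real.sqrt_zero]

/-- Uniform property (A) for a sequence of spaces: averaging operators for functions with values in
a normed space, which replace the value at a point by a mean value over a ball around it. -/
def HasAveraging (X : ℕ → Type*) [∀ n, MetricSpace (X n)] (E : Type*) [NormedAddCommGroup E]
    [NormedSpace ℝ E] : Prop :=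
  ∀ R > (0 : ℝ), ∀ ε > (0 : ℝ), ∃ (S : ℝ) (m : ∀ n, (X n → E) → X n → E),
    (∀ n d x, m n d x ∈ convexHull ℝ (d '' Metric.closedBall x S)) ∧
    ∀ n d, (∀ x, ‖d x‖ ≤ 1) → ∀ x y, dist x y ≤ R → ‖m n d x - m n d y‖ ≤ ε

/-- A ball consists of a ball in its own fibre and of points of one finite set that does not depend
on the centre. -/
theorem IsCoarseDisjointUnion.hasBoundedGeometry {X : ℕ → Type*} [∀ n, MetricSpace (X n)]
    {Y : Type*} [MetricSpace Y] (hY : IsCoarseDisjointUnion X Y)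
    (h : ∀ R : ℝ, ∃ K : ℕ, ∀ n (x : X n),
      (Metric.closedBall x R).Finite ∧ (Metric.closedBall x R).ncard ≤ K) :
    HasBoundedGeometry Y := by
  obtain ⟨D⟩ := hY.nonempty_data
  intro R
  obtain ⟨K, hK⟩ := h R
  obtain ⟨N, E, hE, hcross⟩ := D.cross R
  obtain ⟨r, hr⟩ := Metric.isBounded_iff.1 hE
  have hfin : {y ∈ E | D.p y < N}.Finite := by
    have : {y ∈ E | D.p y < N} ⊆ ⋃ n ∈ Finset.range N, E ∩ Set.range (D.q n) := by
      rintro y ⟨hy, hyN⟩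
      obtain ⟨n, x, rfl⟩ := D.exists_q y
      rw [D.p_q] at hyN
      simp only [Set.mem_iUnion, Finset.mem_range]
      exact ⟨n, hyN, hy, x, rfl⟩
    refine Set.Finite.subset (Set.Finite.biUnion (Finset.finite_toSet _) fun n _ => ?_) this
    rcases (E ∩ Set.range (D.q n)).eq_empty_or_nonempty with h0 | ⟨_, hx, x, rfl⟩
    · rw [h0]; exact Set.finite_empty
    · obtain ⟨K', hK'⟩ := h r
      refine ((hK' n x).1.image (D.q n)).subset ?_
      rintro _ ⟨hz, z, rfl⟩
      refine ⟨z, ?_, rfl⟩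
      rw [Metric.mem_closedBall, ← (D.isometry n).dist_eq]
      exact hr hz hx
  refine ⟨K + {y ∈ E | D.p y < N}.ncard, fun y => ?_⟩
  obtain ⟨n, x, rfl⟩ := D.exists_q y
  have hsub : Metric.closedBall (D.q n x) R ⊆
      D.q n '' Metric.closedBall x R ∪ {y ∈ E | D.p y < N} := by
    intro z hz
    rw [Metric.mem_closedBall] at hz
    by_cases hp : D.p z = n
    · obtain ⟨m, z, rfl⟩ := D.exists_q z
      rw [D.p_q] at hp
      subst hp
      left
      refine ⟨z, ?_, rfl⟩
      rwa [Metric.mem_closedBall, ← (D.isometry _).dist_eq]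
    · right
      exact hcross z (D.q n x) (by rwa [D.p_q]) hz
  have hf1 := (hK n x).1.image (D.q n)
  refine ⟨(hf1.union hfin).subset hsub, (Set.ncard_le_ncard hsub (hf1.union hfin)).trans ?_⟩
  refine (Set.ncard_union_le _ _).trans (Nat.add_le_add_right ?_ _)
  exact (Set.ncard_image_le (hK n x).1).trans (hK n x).2

/-- Averaging point masses in each fibre gives probability measures `ξ`. On the bounded set where
fibres come close, they are replaced by a fixed point mass, with a slowly varying cutoff in between.
-/
theorem IsCoarseDisjointUnion.hasPropertyA {X : ℕ → Type*} [∀ n, MetricSpace (X n)]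
    [∀ n, Nonempty (X n)]
    {Y : Type*} [MetricSpace Y] (hY : IsCoarseDisjointUnion X Y)
    (hbg : ∀ R : ℝ, ∃ K : ℕ, ∀ n (x : X n),
      (Metric.closedBall x R).Finite ∧ (Metric.closedBall x R).ncard ≤ K)
    (h : HasAveraging X (lp (fun _ : Y => ℝ) 1)) :
    HasPropertyA Y := by
  obtain ⟨D⟩ := hY.nonempty_data
  refine HasPropertyA.of_convexHull (hY.hasBoundedGeometry hbg) fun R hR ε hε => ?_
  obtain ⟨S, m, hm, hclose⟩ := h R hR (ε / 2) (by positivity)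
  obtain ⟨ξ, hξ⟩ := D.exists_extend fun n => m n fun x => pointMass (D.q n x)
  obtain ⟨N, U, hU, hcross⟩ := D.cross R
  obtain ⟨y₀⟩ : Nonempty Y := ⟨D.q 0 (Classical.arbitrary _)⟩
  -- The slope `1 / L` makes the cutoff vary by at most `ε / 4` over a distance `R`.
  set L : ℝ := 4 * R / ε with hL
  have hLpos : 0 < L := by positivity
  -- Adding `y₀` keeps `V` nonempty: `infDist` to the empty set is 0, and the cutoff would then be 1
  -- everywhere.
  set V := insert y₀ U
  set c : Y → ℝ := fun y => max 0 (1 - Metric.infDist y V / L) with hc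
  have hc0 : ∀ y, 0 ≤ c y := fun y => le_max_left _ _
  have hc1 : ∀ y, c y ≤ 1 := fun y => by
    have : 0 ≤ Metric.infDist y V / L := div_nonneg Metric.infDist_nonneg hLpos.le
    exact max_le zero_le_one (by linarith)
  have hclip : ∀ x y, dist x y ≤ R → |c x - c y| ≤ ε / 4 := by
    intro x y hxy
    refine (abs_max_sub_max_le_max _ _ _ _).trans ?_
    rw [sub_self, abs_zero, sub_sub_sub_cancel_left, ← sub_div, abs_div, abs_of_pos hLpos]
    refine max_le (by positivity) ?_
    rw [div_le_iff₀ hLpos]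
    have h1 := Metric.infDist_le_infDist_add_dist (s := V) (x := x) (y := y)
    have h2 := Metric.infDist_le_infDist_add_dist (s := V) (x := y) (y := x)
    rw [dist_comm y x] at h2
    have : ε / 4 * L = R := by rw [hL]; field_simp
    rw [this, abs_le]
    constructor <;> linarith
  have hcU : ∀ y ∈ U, c y = 1 := fun y hy => by
    rw [hc]
    simp only
    rw [Metric.infDist_zero_of_mem (Set.mem_insert_of_mem _ hy)]
    simp
  obtain ⟨r, hr⟩ := Metric.isBounded_iff.1 (hU.insert y₀)
  have hcsupp : ∀ y, c y ≠ 0 → dist y₀ y ≤ r + L := by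
    intro y hy
    have hlt : Metric.infDist y V < L := by
      by_contra! hle
      apply hy
      refine max_eq_left ?_
      have := (one_le_div hLpos).2 hle
      linarith
    obtain ⟨z, hz, hyz⟩ := (Metric.infDist_lt_iff ⟨y₀, Set.mem_insert _ _⟩).1 hlt
    have h1 := hr (Set.mem_insert y₀ U) hz
    have h2 := dist_triangle y₀ z y
    rw [dist_comm z y] at h2
    linarith
  have hξmem : ∀ y, ξ y ∈ convexHull ℝ (pointMass '' Metric.closedBall y S) := by
    intro y
    obtain ⟨n, x, rfl⟩ := D.exists_q y
    rw [hξ]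
    refine convexHull_mono ?_ (hm n _ x)
    rintro _ ⟨z, hz, rfl⟩
    refine ⟨D.q n z, ?_, rfl⟩
    rwa [Metric.mem_closedBall, (D.isometry n).dist_eq]
  have hξn : ∀ y, ‖ξ y‖ ≤ 1 := fun y =>
    FreeProduct.norm_le_one_of_mem_convexHull (fun z => (norm_pointMass z).le) (hξmem y)
  refine ⟨max S (r + L), fun y => c y • pointMass y₀ + (1 - c y) • ξ y, fun y => ?_,
    fun x y hxy => ?_⟩
  · set W := convexHull ℝ (pointMass '' Metric.closedBall y (max S (r + L)))
    have hξW : ξ y ∈ W := convexHull_mono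
      (Set.image_mono (Metric.closedBall_subset_closedBall (le_max_left _ _))) (hξmem y)
    by_cases h0 : c y = 0
    · simpa [h0] using hξW
    · have hy₀ : pointMass y₀ ∈ W := subset_convexHull ℝ _
        ⟨y₀, (hcsupp y h0).trans (le_max_right _ _), rfl⟩
      exact (convex_convexHull ℝ _) hy₀ hξW (hc0 y) (by linarith [hc1 y]) (by ring)
  · by_cases hp : D.p x = D.p y
    · have hxy' : ‖ξ x - ξ y‖ ≤ ε / 2 := by
        obtain ⟨n, x, rfl⟩ := D.exists_q x
        obtain ⟨k, y, rfl⟩ := D.exists_q y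
        rw [D.p_q, D.p_q] at hp
        subst hp
        rw [hξ, hξ]
        rw [(D.isometry n).dist_eq] at hxy
        exact hclose n _ (fun z => (norm_pointMass _).le) x y hxy
      have : c x • pointMass y₀ + (1 - c x) • ξ x - (c y • pointMass y₀ + (1 - c y) • ξ y)
          = (c x - c y) • (pointMass y₀ - ξ y) + (1 - c x) • (ξ x - ξ y) := by module
      rw [this]
      refine (norm_add_le _ _).trans ?_
      rw [norm_smul, norm_smul, Real.norm_eq_abs, Real.norm_eq_abs]
      have h1 := mul_le_mul (hclip x y hxy)
        ((norm_sub_le (pointMass y₀) (ξ y)).trans (add_le_add (norm_pointMass y₀).le (hξn y)))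
        (norm_nonneg _) (by positivity)
      have h2 : |1 - c x| ≤ 1 := by
        rw [abs_le]; constructor <;> linarith [hc0 x, hc1 x]
      have h3 := mul_le_mul h2 hxy' (norm_nonneg _) zero_le_one
      linarith
    · have hx := (hcross x y hp hxy).1
      have hy := (hcross y x (Ne.symm hp) (by rwa [dist_comm])).1
      simp only [hcU x hx, hcU y hy, sub_self, zero_smul, norm_zero]
      exact hε.le

/-- Cauchy–Schwarz applied to the factored difference of squares; it turns `ℓ²` closeness of vectors
into `ℓ¹` closeness of their squares. -/
theorem sum_abs_sq_sub_sq_le {X : Type*} (f g : lp (fun _ : X => ℝ) 2) (s : Finset X) :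
    ∑ y ∈ s, |f y ^ 2 - g y ^ 2| ≤ ‖f - g‖ * ‖f + g‖ := by
  have hle : ∀ f : lp (fun _ : X => ℝ) 2, √(∑ y ∈ s, |f y| ^ 2) ≤ ‖f‖ := fun f => by
    rw [Real.sqrt_le_left (norm_nonneg _)]
    simp only [sq_abs]
    exact sum_le_hasSum s (fun y _ => sq_nonneg _) (hasSum_sq_lp_two f)
  calc ∑ y ∈ s, |f y ^ 2 - g y ^ 2| = ∑ y ∈ s, |(f - g) y| * |(f + g) y| := by
        refine Finset.sum_congr rfl fun y _ => ?_
        rw [← abs_mul, lp.coeFn_sub, lp.coeFn_add, Pi.sub_apply, Pi.add_apply]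
        ring_nf
    _ ≤ _ := Real.sum_mul_le_sqrt_mul_sqrt _ _ _
    _ ≤ _ := mul_le_mul (hle _) (hle _) (Real.sqrt_nonneg _) (norm_nonneg _)

/-- A coarse disjoint union with property (A) provides averaging operators on the fibres, and
slowly varying cutoff functions of bounded width. -/
theorem IsCoarseDisjointUnion.exists_averaging {X : ℕ → Type*} [∀ n, MetricSpace (X n)]
    [∀ n, Nonempty (X n)] {Y : Type*} [MetricSpace Y] (hY : IsCoarseDisjointUnion X Y)
    (hA : HasPropertyA Y) (E : Type*) [NormedAddCommGroup E] [NormedSpace ℝ E]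
    {R : ℝ} (hR : 0 < R) {ε : ℝ} (hε : 0 < ε) :
    ∃ (S : ℝ) (m : ∀ n, (X n → E) → X n → E) (c : ∀ n, X n → X n → ℝ),
      (∀ n d x, m n d x ∈ convexHull ℝ (d '' Metric.closedBall x S)) ∧
      (∀ n d, (∀ x, ‖d x‖ ≤ 1) → ∀ x y, dist x y ≤ R → ‖m n d x - m n d y‖ ≤ ε) ∧
      (∀ n x, c n x x = 1) ∧ (∀ n x y, c n x y ∈ Set.Icc (0 : ℝ) 1) ∧
      (∀ n x y, c n x y ≠ 0 → dist x y ≤ S) ∧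
      ∀ n x y z, dist x y ≤ R → |c n x z - c n y z| ≤ ε := by
  classical
  obtain ⟨D⟩ := hY.nonempty_data
  obtain ⟨hbg, hA⟩ := hA
  -- For unit vectors `‖φ x - φ y‖ ^ 2` is twice `1 - ⟨φ x, φ y⟩`, hence at most `ε ^ 2 / 4` with
  -- this choice.
  obtain ⟨S, hS, φ, hφ1, hφc, hφs⟩ := hA R hR (ε ^ 2 / 8) (by positivity)
  obtain ⟨_, hK⟩ := hbg S
  have hclose : ∀ n (x y : X n), dist x y ≤ R → ‖φ (D.q n x) - φ (D.q n y)‖ ≤ ε / 2 := by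
    intro n x y hxy
    rw [← (D.isometry n).dist_eq] at hxy
    have h1 := (abs_le.1 (hφc _ _ hxy)).2
    have h2 := norm_sub_sq_real (φ (D.q n x)) (φ (D.q n y))
    rw [hφ1, hφ1] at h2
    exact abs_le_of_sq_le_sq' (by nlinarith) (by positivity) |>.2
  have hsupp : ∀ x y : Y, inner ℝ (φ x) (φ y) ≠ 0 → dist x y ≤ 2 * S := by
    intro x y h
    by_contra! hlt
    apply h
    rw [lp.inner_eq_tsum]
    have : ∀ z, inner ℝ (φ x z) (φ y z) = 0 := by
      intro z
      by_cases hx : φ x z = 0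
      · rw [hx, inner_zero_left]
      by_cases hy : φ y z = 0
      · rw [hy, inner_zero_right]
      have h1 : dist z x ≤ S := hφs x z hx
      have h2 : dist z y ≤ S := hφs y z hy
      have := dist_triangle_left x y z
      linarith
    simp only [this, tsum_zero]
  -- The support of `φ` may leave the fibre; `r` brings its points back at an additional distance of
  -- at most `S`.
  set r : ∀ n, Y → X n := fun n y =>
    if h : ∃ x, dist (D.q n x) y ≤ S then h.choose else Classical.arbitrary _ with hr
  have hrS : ∀ n x y, φ (D.q n x) y ≠ 0 → dist (r n y) x ≤ 2 * S := by
    intro n x y hy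
    have h1 : dist y (D.q n x) ≤ S := hφs _ _ hy
    have h : ∃ x, dist (D.q n x) y ≤ S := ⟨x, by rwa [dist_comm]⟩
    have h2 : dist (D.q n (r n y)) y ≤ S := by
      simp only [hr, dif_pos h]
      exact h.choose_spec
    rw [← (D.isometry n).dist_eq]
    linarith [dist_triangle (D.q n (r n y)) y (D.q n x)]
  have hsum : ∀ (y : Y) (s : Finset Y), (hK y).1.toFinset ⊆ s → ∑ z ∈ s, φ y z ^ 2 = 1 := by
    intro y s hs
    have h1 := hasSum_sq_lp_two (φ y)
    rw [hφ1, one_pow] at h1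
    refine (hasSum_sum_of_ne_finset_zero fun z hz => ?_).unique h1
    by_contra h0
    exact hz (hs ((hK y).1.mem_toFinset.2 (hφs y z fun h => h0 (by rw [h]; norm_num))))
  -- The squares of `φ` serve as weights. Inner products of `φ` serve as cutoffs: they vanish once
  -- two supports of radius `S` are disjoint, and vary slowly by Cauchy–Schwarz.
  refine ⟨2 * S, fun n d x => ∑ y ∈ (hK (D.q n x)).1.toFinset, φ (D.q n x) y ^ 2 • d (r n y),
    fun n x y => |inner ℝ (φ (D.q n x)) (φ (D.q n y))|, fun n d x => ?_, fun n d hd x y hxy => ?_,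
    fun n x => ?_, fun n x y => ⟨abs_nonneg _, ?_⟩, fun n x y h => ?_, fun n x y z hxy => ?_⟩
  · beta_reduce
    set s := (hK (D.q n x)).1.toFinset
    rw [← Finset.sum_filter_of_ne (p := fun y => φ (D.q n x) y ≠ 0)]
    · refine (convex_convexHull ℝ _).sum_mem (fun _ _ => sq_nonneg _) ?_ fun y hy => ?_
      · rw [Finset.sum_filter_of_ne]
        · exact hsum _ _ subset_rfl
        · intro y _ h h0
          exact h (by rw [h0]; norm_num)
      · exact subset_convexHull ℝ _ ⟨r n y, hrS n x y (Finset.mem_filter.1 hy).2, rfl⟩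
    · intro y _ h h0
      exact h (by rw [h0]; simp)
  · beta_reduce
    set s := (hK (D.q n x)).1.toFinset
    set t := (hK (D.q n y)).1.toFinset
    have hext : ∀ (x : Y) (u : Finset Y), (hK x).1.toFinset ⊆ u →
        ∑ z ∈ (hK x).1.toFinset, φ x z ^ 2 • d (r n z) = ∑ z ∈ u, φ x z ^ 2 • d (r n z) := by
      intro x u hu
      refine Finset.sum_subset hu fun z _ hz => ?_
      have : φ x z = 0 := by
        by_contra h
        exact hz ((hK x).1.mem_toFinset.2 (hφs x z h))
      simp [this]
    rw [hext _ (s ∪ t) Finset.subset_union_left, hext _ (s ∪ t) Finset.subset_union_right,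
      ← Finset.sum_sub_distrib]
    calc ‖∑ z ∈ s ∪ t, (φ (D.q n x) z ^ 2 • d (r n z) - φ (D.q n y) z ^ 2 • d (r n z))‖
        ≤ ∑ z ∈ s ∪ t, |φ (D.q n x) z ^ 2 - φ (D.q n y) z ^ 2| := by
          refine norm_sum_le_of_le _ fun z _ => ?_
          rw [← sub_smul, norm_smul, Real.norm_eq_abs]
          exact mul_le_of_le_one_right (abs_nonneg _) (hd _)
      _ ≤ ‖φ (D.q n x) - φ (D.q n y)‖ * ‖φ (D.q n x) + φ (D.q n y)‖ := sum_abs_sq_sub_sq_le _ _ _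
      _ ≤ ε / 2 * 2 := by
          refine mul_le_mul (hclose n x y hxy) ?_ (norm_nonneg _) (by positivity)
          refine (norm_add_le _ _).trans ?_
          rw [hφ1, hφ1]; norm_num
      _ = ε := by ring
  · simp only
    rw [real_inner_self_eq_norm_sq, hφ1]
    norm_num
  · refine (abs_real_inner_le_norm _ _).trans ?_
    rw [hφ1, hφ1, one_mul]
  · rw [← (D.isometry n).dist_eq]
    exact hsupp _ _ (abs_ne_zero.1 h)
  · refine (abs_abs_sub_abs_le_abs_sub _ _).trans ?_
    rw [← inner_sub_left]
    refine (abs_real_inner_le_norm _ _).trans ?_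
    rw [hφ1, mul_one]
    linarith [hclose n x y hxy]

end PropertyA

/-! ### Uniform estimates for sequences of quotients -/

section LengthQuotient

variable {Γ Q : Type u} [Group Γ] [Group Q] {ℓ : ProperLength Γ} {π : Γ →* Q}
  {hπ : Function.Surjective π}

variable (ℓ π hπ) in
/-- The identity, from a quotient group to the corresponding metric space. -/
def toLengthQuotient : Q ≃ LengthQuotient ℓ π hπ := Equiv.refl Q

theorem exists_of_dist_toLengthQuotient_le {x y : Q} {R : ℝ}
    (h : dist (toLengthQuotient ℓ π hπ x) (toLengthQuotient ℓ π hπ y) ≤ R) :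
    ∃ γ, ℓ γ ≤ R ∧ π γ = x⁻¹ * y := by
  obtain ⟨γ, hγ, hl⟩ := exists_quotientLength_eq ℓ π hπ (x⁻¹ * y)
  exact ⟨γ, hl.trans_le h, hγ⟩

theorem dist_toLengthQuotient_le {x y : Q} {γ : Γ} (h : π γ = x⁻¹ * y) :
    dist (toLengthQuotient ℓ π hπ x) (toLengthQuotient ℓ π hπ y) ≤ ℓ γ := by
  change quotientLength ℓ π (x⁻¹ * y) ≤ ℓ γ
  rw [← h]
  exact quotientLength_le ℓ π γ

theorem dist_toLengthQuotient_inv_le (x : Q) (γ : Γ) :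
    dist (toLengthQuotient ℓ π hπ (π γ * x)⁻¹) (toLengthQuotient ℓ π hπ x⁻¹) ≤ ℓ γ :=
  dist_toLengthQuotient_le (by simp)

variable (ℓ) in
theorem ProperLength.exists_le_of_finite {T : Set Γ} (hT : T.Finite) : ∃ S : ℝ, ∀ γ ∈ T, ℓ γ ≤ S := by
  obtain ⟨S, hS⟩ := (hT.image ℓ).bddAbove
  exact ⟨S, fun γ hγ => hS ⟨γ, hγ, rfl⟩⟩

end LengthQuotient

section Sequences

variable {Γ : Type u} [Group Γ] {Q : ℕ → Type u} [∀ n, Group (Q n)]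

/-- Maps on a sequence of quotients which are coarse embeddings, uniformly, for the right invariant
coarse structures that come from the finite subsets of the group. -/
def UniformlyCoarse (π : ∀ n, Γ →* Q n) {E : ℕ → Type u} [∀ n, NormedAddCommGroup (E n)]
    (f : ∀ n, Q n → E n) : Prop :=
  (∀ γ, ∃ C : ℝ, ∀ n x, ‖f n (π n γ * x) - f n x‖ ≤ C) ∧
  ∀ S : ℝ, ∃ T : Set Γ, T.Finite ∧ ∀ n x y, ‖f n x - f n y‖ ≤ S → x * y⁻¹ ∈ π n '' T

/-- Sequences of averaging operators on a sequence of quotients, of widths given by finite subsets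
of the group, which are asymptotically invariant. -/
def UniformlyAveraging (π : ∀ n, Γ →* Q n) {E : Type u} [NormedAddCommGroup E] [NormedSpace ℝ E]
    (T : ℕ → Set Γ) (m : ℕ → ∀ n, (Q n → E) → Q n → E) : Prop :=
  (∀ j n d x, m j n d x ∈ convexHull ℝ (d '' {q | q * x⁻¹ ∈ π n '' T j})) ∧
  ∀ γ, ∀ ε > (0 : ℝ), ∀ᶠ j in atTop, ∀ n d, (∀ x, ‖d x‖ ≤ 1) → ∀ x,
    ‖m j n d (π n γ * x) - m j n d x‖ ≤ ε

/-- Sequences of cutoff functions on a sequence of quotients, of widths given by finite subsets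
of the group, which are asymptotically invariant. -/
def UniformlyCutoff (π : ∀ n, Γ →* Q n) (T : ℕ → Set Γ) (c : ℕ → ∀ n, Q n → ℝ) : Prop :=
  (∀ j n, c j n 1 = 1) ∧ (∀ j n x, c j n x ∈ Set.Icc (0 : ℝ) 1) ∧
  (∀ j n x, c j n x ≠ 0 → x⁻¹ ∈ π n '' T j) ∧
  ∀ γ, ∀ ε > (0 : ℝ), ∀ᶠ j in atTop, ∀ n x, |c j n (π n γ * x) - c j n x| ≤ ε

variable {ℓ : ProperLength Γ} {π : ∀ n, Γ →* Q n} {hπ : ∀ n, Function.Surjective (π n)}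
  {X : Type u} [MetricSpace X]

/-- Composing with inversion exchanges left and right invariance, and subtracting the value at 1
normalises without changing distances. -/
theorem exists_uniformlyCoarse
    (hX : IsCoarseDisjointUnion (fun n => LengthQuotient ℓ (π n) (hπ n)) X)
    {H : Type u} [NormedAddCommGroup H] {F : X → H}
    (h₁ : ∀ R : ℝ, ∃ S : ℝ, ∀ x y, dist x y ≤ R → ‖F x - F y‖ ≤ S)
    (h₂ : ∀ S : ℝ, ∃ R : ℝ, ∀ x y, ‖F x - F y‖ ≤ S → dist x y ≤ R)
    (hsep : ∀ x y, x ≠ y → 1 ≤ ‖F x - F y‖) :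
    ∃ f : ∀ n, Q n → H, UniformlyCoarse π f ∧ (∀ n, f n 1 = 0) ∧
      ∀ n x y, x ≠ y → 1 ≤ ‖f n x - f n y‖ := by
  obtain ⟨D⟩ := hX.nonempty_data
  set e := fun n => toLengthQuotient ℓ (π n) (hπ n)
  refine ⟨fun n x => F (D.q n (e n x⁻¹)) - F (D.q n (e n 1)), ⟨fun γ => ?_, fun S => ?_⟩,
    fun n => by simp, fun n x y hxy => ?_⟩
  · obtain ⟨S, hS⟩ := h₁ (ℓ γ)
    refine ⟨S, fun n x => ?_⟩
    rw [sub_sub_sub_cancel_right]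
    apply hS
    rw [(D.isometry n).dist_eq]
    exact dist_toLengthQuotient_inv_le x γ
  · obtain ⟨R, hR⟩ := h₂ S
    refine ⟨{γ | ℓ γ ≤ R}, ℓ.proper R, fun n x y hxy => ?_⟩
    rw [sub_sub_sub_cancel_right] at hxy
    have := hR _ _ hxy
    rw [(D.isometry n).dist_eq] at this
    obtain ⟨γ, hγ, h⟩ := exists_of_dist_toLengthQuotient_le this
    exact ⟨γ, hγ, by rw [h, inv_inv]⟩
  · rw [sub_sub_sub_cancel_right]
    refine hsep _ _ fun h => hxy ?_
    exact inv_injective ((e n).injective ((D.isometry n).injective h))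

theorem UniformlyCoarse.coarselyEmbedsIntoHilbert
    (hX : IsCoarseDisjointUnion (fun n => LengthQuotient ℓ (π n) (hπ n)) X)
    {E : ℕ → Type u} [∀ n, NormedAddCommGroup (E n)] [∀ n, InnerProductSpace ℝ (E n)]
    [∀ n, CompleteSpace (E n)] {f : ∀ n, Q n → E n} (hf : UniformlyCoarse π f) :
    CoarselyEmbedsIntoHilbert X := by
  obtain ⟨h₁, h₂⟩ := hf
  set e := fun n => toLengthQuotient ℓ (π n) (hπ n)
  refine hX.coarselyEmbedsIntoHilbert (fun n x => f n ((e n).symm x)⁻¹) (fun R => ?_) fun S => ?_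
  · choose C hC using h₁
    obtain ⟨S, hS⟩ := ((ℓ.proper R).image C).bddAbove
    refine ⟨S, fun n x y hxy => ?_⟩
    obtain ⟨x, rfl⟩ := (e n).surjective x
    obtain ⟨y, rfl⟩ := (e n).surjective y
    obtain ⟨γ, hγ, h⟩ := exists_of_dist_toLengthQuotient_le hxy
    simp only [Equiv.symm_apply_apply]
    have hx : x⁻¹ = π n γ * y⁻¹ := by rw [h, mul_inv_cancel_right]
    rw [hx]
    exact (hC γ n y⁻¹).trans (hS ⟨γ, hγ, rfl⟩)
  · obtain ⟨T, hT, h⟩ := h₂ S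
    obtain ⟨R, hR⟩ := ℓ.exists_le_of_finite hT
    refine ⟨R, fun n x y hxy => ?_⟩
    obtain ⟨x, rfl⟩ := (e n).surjective x
    obtain ⟨y, rfl⟩ := (e n).surjective y
    simp only [Equiv.symm_apply_apply] at hxy
    obtain ⟨γ, hγ, hγ'⟩ := h n _ _ hxy
    exact (dist_toLengthQuotient_le (by rw [hγ', inv_inv])).trans (hR γ hγ)

theorem exists_uniformlyAveraging
    (hX : IsCoarseDisjointUnion (fun n => LengthQuotient ℓ (π n) (hπ n)) X)
    (hA : HasPropertyA X) (E : Type u) [NormedAddCommGroup E] [NormedSpace ℝ E] :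
    ∃ (T : ℕ → Set Γ) (m : ℕ → ∀ n, (Q n → E) → Q n → E) (c : ℕ → ∀ n, Q n → ℝ),
      (∀ j, (T j).Finite) ∧ UniformlyAveraging π T m ∧ UniformlyCutoff π T c := by
  set e := fun n => toLengthQuotient ℓ (π n) (hπ n)
  have : ∀ n, Nonempty (LengthQuotient ℓ (π n) (hπ n)) := fun n => ⟨e n 1⟩
  -- With scale `j + 1` and error `1 / (j + 1)`, each fixed `γ` is eventually shorter than the
  -- scale, and the error tends to 0.
  choose S m c hm hmc hc1 hc01 hcS hcc using fun j : ℕ =>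
    hX.exists_averaging hA E (R := j + 1) (by positivity) (ε := 1 / ((j : ℝ) + 1)) (by positivity)
  have hev : ∀ γ : Γ, ∀ ε > (0 : ℝ), ∀ᶠ j : ℕ in atTop,
      ℓ γ ≤ (j : ℝ) + 1 ∧ 1 / ((j : ℝ) + 1) ≤ ε := by
    intro γ ε hε
    have h1 := (tendsto_one_div_add_atTop_nhds_zero_nat (𝕜 := ℝ)).eventually (ge_mem_nhds hε)
    have h2 := (tendsto_natCast_atTop_atTop (R := ℝ)).eventually_ge_atTop (ℓ γ)
    filter_upwards [h1, h2] with j hj1 hj2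
    exact ⟨by linarith, hj1⟩
  refine ⟨fun j => {γ | ℓ γ ≤ S j}, fun j n d x => m j n (fun y => d ((e n).symm y)⁻¹) (e n x⁻¹),
    fun j n x => c j n (e n x⁻¹) (e n 1), fun j => ℓ.proper _, ⟨fun j n d x => ?_,
    fun γ ε hε => ?_⟩, fun j n => ?_, fun j n x => hc01 _ _ _ _, fun j n x hx => ?_,
    fun γ ε hε => ?_⟩
  · refine convexHull_mono ?_ (hm j n _ _)
    rintro _ ⟨y, hy, rfl⟩
    obtain ⟨y, rfl⟩ := (e n).surjective y
    obtain ⟨γ, hγ, h⟩ := exists_of_dist_toLengthQuotient_le (Metric.mem_closedBall.1 hy)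
    exact ⟨y⁻¹, ⟨γ, hγ, h⟩, by simp⟩
  · filter_upwards [hev γ ε hε] with j hj n d hd x
    exact (hmc j n _ (fun y => hd _) _ _ ((dist_toLengthQuotient_inv_le x γ).trans hj.1)).trans hj.2
  · simp only [inv_one]
    exact hc1 j n _
  · have := hcS j n _ _ hx
    rw [dist_comm] at this
    obtain ⟨γ, hγ, h⟩ := exists_of_dist_toLengthQuotient_le this
    exact ⟨γ, hγ, by rw [h, inv_one, one_mul]⟩
  · filter_upwards [hev γ ε hε] with j hj n x
    exact (hcc j n _ _ _ ((dist_toLengthQuotient_inv_le x γ).trans hj.1)).trans hj.2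

theorem UniformlyAveraging.hasAveraging {E : Type u} [NormedAddCommGroup E] [NormedSpace ℝ E]
    {T : ℕ → Set Γ} (hT : ∀ j, (T j).Finite)
    {m : ℕ → ∀ n, (Q n → E) → Q n → E} (hm : UniformlyAveraging π T m) :
    HasAveraging (fun n => LengthQuotient ℓ (π n) (hπ n)) E := by
  intro R _ ε hε
  set e := fun n => toLengthQuotient ℓ (π n) (hπ n)
  -- Only finitely many `γ` have length at most `R`, so a single `j` serves them all.
  have hev := (eventually_all_finite (ℓ.proper R)).2 fun γ _ => hm.2 γ ε hε
  obtain ⟨j, hj⟩ := hev.exists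
  obtain ⟨S, hS⟩ := ℓ.exists_le_of_finite (hT j)
  refine ⟨S, fun n d x => m j n (fun q => d (e n q⁻¹)) ((e n).symm x)⁻¹, fun n d x => ?_,
    fun n d hd x y hxy => ?_⟩
  · obtain ⟨x, rfl⟩ := (e n).surjective x
    refine convexHull_mono ?_ (hm.1 j n _ _)
    rintro _ ⟨q, ⟨γ, hγ, h⟩, rfl⟩
    refine ⟨e n q⁻¹, ?_, rfl⟩
    refine (dist_toLengthQuotient_le (γ := γ) ?_).trans (hS γ hγ)
    rw [h, Equiv.symm_apply_apply, inv_inv, inv_inv]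
  · obtain ⟨x, rfl⟩ := (e n).surjective x
    obtain ⟨y, rfl⟩ := (e n).surjective y
    obtain ⟨γ, hγ, h⟩ := exists_of_dist_toLengthQuotient_le hxy
    simp only [Equiv.symm_apply_apply]
    have hx : x⁻¹ = π n γ * y⁻¹ := by rw [h, mul_inv_cancel_right]
    rw [hx]
    exact hj γ hγ n _ (fun q => hd _) _

variable (ℓ π hπ) in
theorem LengthQuotient.uniformly_boundedGeometry (R : ℝ) : ∃ K : ℕ, ∀ n,
    ∀ x : LengthQuotient ℓ (π n) (hπ n),
      (Metric.closedBall x R).Finite ∧ (Metric.closedBall x R).ncard ≤ K := by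
  refine ⟨{γ | ℓ γ ≤ R}.ncard, fun n x => ?_⟩
  set e := toLengthQuotient ℓ (π n) (hπ n)
  obtain ⟨x, rfl⟩ := e.surjective x
  have hsub : Metric.closedBall (e x) R ⊆ (fun γ => e (x * π n γ)) '' {γ | ℓ γ ≤ R} := by
    intro y hy
    obtain ⟨y, rfl⟩ := e.surjective y
    rw [Metric.mem_closedBall'] at hy
    obtain ⟨γ, hγ, h⟩ := exists_of_dist_toLengthQuotient_le hy
    refine ⟨γ, hγ, ?_⟩
    simp only [h, mul_inv_cancel_left]
  have hfin := (ℓ.proper R).image fun γ => e (x * π n γ)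
  exact ⟨hfin.subset hsub, (Set.ncard_le_ncard hsub hfin).trans (Set.ncard_image_le (ℓ.proper R))⟩

end Sequences

/-! ### Free products of sequences of quotients -/

section FreeProducts

open Monoid FreeProduct
open scoped Pointwise

variable {A B : Type u} [Group A] [Group B] {P Q : ℕ → Type u} [∀ n, Group (P n)]
  [∀ n, Group (Q n)] {α : ∀ n, A →* P n} {β : ∀ n, B →* Q n}

/-- The elements of a free product that come from given subsets of the factors. -/
def letters (S : Set A) (T : Set B) : Set (Coprod A B) :=
  insert 1 (Coprod.inl '' S ∪ Coprod.inr '' T)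

theorem finite_letters_pow {S : Set A} {T : Set B} (hS : S.Finite) (hT : T.Finite) (k : ℕ) :
    (letters S T ^ k).Finite := by
  induction k with
  | zero => simp
  | succ k ih =>
    rw [pow_succ]
    exact ih.mul (((hS.image _).union (hT.image _)).insert 1)

variable (α β) in
/-- The images of the letters in the indexed free product of the quotients. -/
def quotientLetters (S : Set A) (T : Set B) (n : ℕ) : Set (CoprodI (pair (P n) (Q n))) :=
  (coprodEquiv (P n) (Q n)).toMonoidHom.comp (Coprod.map (α n) (β n)) '' letters S T

theorem one_mem_quotientLetters (S : Set A) (T : Set B) (n : ℕ) :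
    1 ∈ quotientLetters α β S T n := ⟨1, Set.mem_insert _ _, map_one _⟩

theorem of_mem_quotientLetters_left {S : Set A} (T : Set B) {n : ℕ} {x : P n}
    (hx : x ∈ α n '' S) :
    CoprodI.of (M := pair (P n) (Q n)) (i := ⟨true⟩) x ∈ quotientLetters α β S T n := by
  obtain ⟨a, ha, rfl⟩ := hx
  refine ⟨Coprod.inl a, Or.inr (Or.inl ⟨a, ha, rfl⟩), ?_⟩
  rw [MonoidHom.comp_apply, Coprod.map_apply_inl]
  exact coprodEquiv_inl _

theorem of_mem_quotientLetters_right (S : Set A) {T : Set B} {n : ℕ} {x : Q n}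
    (hx : x ∈ β n '' T) :
    CoprodI.of (M := pair (P n) (Q n)) (i := ⟨false⟩) x ∈ quotientLetters α β S T n := by
  obtain ⟨b, hb, rfl⟩ := hx
  refine ⟨Coprod.inr b, Or.inr (Or.inr ⟨b, hb, rfl⟩), ?_⟩
  rw [MonoidHom.comp_apply, Coprod.map_apply_inr]
  exact coprodEquiv_inr _

theorem mem_image_letters_pow {S : Set A} {T : Set B} {n k : ℕ} {g h : Coprod (P n) (Q n)}
    (hgh : coprodEquiv (P n) (Q n) g * (coprodEquiv (P n) (Q n) h)⁻¹
      ∈ quotientLetters α β S T n ^ k) :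
    g * h⁻¹ ∈ Coprod.map (α n) (β n) '' (letters S T ^ k) := by
  rw [quotientLetters, ← Set.image_pow, ← map_inv, ← map_mul] at hgh
  obtain ⟨γ, hγ, h⟩ := hgh
  exact ⟨γ, hγ, (coprodEquiv (P n) (Q n)).injective h⟩

theorem UniformlyCoarse.coprod {H : Type u} [NormedAddCommGroup H] [InnerProductSpace ℝ H]
    {f : ∀ n, P n → H} {g : ∀ n, Q n → H} (hf : UniformlyCoarse α f) (hg : UniformlyCoarse β g)
    (hf1 : ∀ n, f n 1 = 0) (hg1 : ∀ n, g n 1 = 0)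
    (hfs : ∀ n x y, x ≠ y → 1 ≤ ‖f n x - f n y‖) (hgs : ∀ n x y, x ≠ y → 1 ≤ ‖g n x - g n y‖) :
    UniformlyCoarse (fun n => Coprod.map (α n) (β n)) fun n w =>
      wordMap (pairRec (C := fun b => pair (P n) (Q n) b → H) (f n) (g n))
        (reducedList (coprodEquiv (P n) (Q n) w)) := by
  set h := fun n => pairRec (C := fun b => pair (P n) (Q n) b → H) (f n) (g n)
  have h1 : ∀ n i, h n i 1 = 0 := by
    rintro n ⟨_ | _⟩
    exacts [hg1 n, hf1 n]
  have hs : ∀ n i (x y : pair (P n) (Q n) i), x ≠ y → 1 ≤ ‖h n i x - h n i y‖ := by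
    rintro n ⟨_ | _⟩
    exacts [hgs n, hfs n]
  refine ⟨fun γ => ?_, fun S => ?_⟩
  -- Letters generate, and the constants of a product add up.
  · induction γ using Coprod.induction_on with
    | inl a =>
      obtain ⟨C, hC⟩ := hf.1 a
      refine ⟨C, fun n w => ?_⟩
      beta_reduce
      rw [Coprod.map_apply_inl, map_mul, coprodEquiv_inl]
      obtain ⟨x, hx⟩ := exists_norm_wordMap_of_mul_sub (h1 n) ⟨true⟩ (α n a)
        (coprodEquiv (P n) (Q n) w)
      exact hx.trans_le (hC n x)
    | inr b =>
      obtain ⟨C, hC⟩ := hg.1 b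
      refine ⟨C, fun n w => ?_⟩
      beta_reduce
      rw [Coprod.map_apply_inr, map_mul, coprodEquiv_inr]
      obtain ⟨x, hx⟩ := exists_norm_wordMap_of_mul_sub (h1 n) ⟨false⟩ (β n b)
        (coprodEquiv (P n) (Q n) w)
      exact hx.trans_le (hC n x)
    | mul γ δ hγ hδ =>
      obtain ⟨C, hC⟩ := hγ
      obtain ⟨C', hC'⟩ := hδ
      refine ⟨C + C', fun n w => ?_⟩
      rw [map_mul (Coprod.map (α n) (β n)), mul_assoc]
      exact (norm_sub_le_norm_sub_add_norm_sub _ _ _).trans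
        (add_le_add (hC n _) (hC' n w))
  -- The factors are used at scale `√m`, so that the budget `m` is an integer and equals the square
  -- of the scale.
  · set m := ⌈S ^ 2⌉₊
    have hm : √(m : ℝ) ^ 2 = m := Real.sq_sqrt (Nat.cast_nonneg m)
    obtain ⟨U, hU, hUf⟩ := hf.2 √m
    obtain ⟨V, hV, hVg⟩ := hg.2 √m
    refine ⟨letters U V ^ m, finite_letters_pow hU hV m, fun n v w hvw => ?_⟩
    refine mem_image_letters_pow ?_
    have key := listProd_mul_inv_mem_pow (h1 n) (hs n) (Real.sqrt_nonneg m)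
      (one_mem_quotientLetters (α := α) (β := β) U V n) ?_ _
      (reducedList (coprodEquiv (P n) (Q n) v)) (reducedList (coprodEquiv (P n) (Q n) w)) le_rfl
      (ne_one_of_mem_reducedList _) (ne_one_of_mem_reducedList _) m hm.ge ?_
    · rwa [listProd_reducedList, listProd_reducedList] at key
    · rintro ⟨_ | _⟩ x y hxy
      · exact of_mem_quotientLetters_right U (hVg n x y hxy)
      · exact of_mem_quotientLetters_left V (hUf n x y hxy)
    · refine le_trans ?_ (Nat.le_ceil _)
      exact pow_le_pow_left₀ (norm_nonneg _) hvw 2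

theorem UniformlyAveraging.coprod {E : Type u} [NormedAddCommGroup E] [NormedSpace ℝ E]
    {S : ℕ → Set A} {T : ℕ → Set B} {m : ℕ → ∀ n, (P n → E) → P n → E}
    {k : ℕ → ∀ n, (Q n → E) → Q n → E} {c : ℕ → ∀ n, P n → ℝ} {b : ℕ → ∀ n, Q n → ℝ}
    (hm : UniformlyAveraging α S m) (hk : UniformlyAveraging β T k)
    (hc : UniformlyCutoff α S c) (hb : UniformlyCutoff β T b) :
    UniformlyAveraging (fun n => Coprod.map (α n) (β n))
      (fun j => letters (S j) (T j) ^ (j + 1)) fun j n d w =>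
        meanWalk (pairRec (C := fun i => pair (P n) (Q n) i → ℝ) (c j n) (b j n))
          (pairRec (C := fun i => (pair (P n) (Q n) i → E) → pair (P n) (Q n) i → E)
            (m j n) (k j n)) (j + 1) (fun g => d ((coprodEquiv (P n) (Q n)).symm g))
            (coprodEquiv (P n) (Q n) w) := by
  set C := fun j n => pairRec (C := fun i => pair (P n) (Q n) i → ℝ) (c j n) (b j n)
  set M := fun j n => pairRec (C := fun i => (pair (P n) (Q n) i → E) → pair (P n) (Q n) i → E)
    (m j n) (k j n)
  have hC1 : ∀ j n i, C j n i 1 = 1 := by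
    rintro j n ⟨_ | _⟩
    exacts [hb.1 j n, hc.1 j n]
  have hC01 : ∀ j n i x, C j n i x ∈ Set.Icc (0 : ℝ) 1 := by
    rintro j n ⟨_ | _⟩
    exacts [hb.2.1 j n, hc.2.1 j n]
  have hCT : ∀ j n i x, C j n i x ≠ 0 →
      CoprodI.of x⁻¹ ∈ quotientLetters α β (S j) (T j) n := by
    rintro j n ⟨_ | _⟩ x hx
    · exact of_mem_quotientLetters_right _ (hb.2.2.1 j n x hx)
    · exact of_mem_quotientLetters_left _ (hc.2.2.1 j n x hx)
  have hMT : ∀ j n i d x, M j n i d x ∈ convexHull ℝ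
      (d '' {q | CoprodI.of (q * x⁻¹) ∈ quotientLetters α β (S j) (T j) n}) := by
    rintro j n ⟨_ | _⟩ d x
    · exact convexHull_mono (Set.image_mono fun q hq => of_mem_quotientLetters_right _ hq)
        (hk.1 j n d x)
    · exact convexHull_mono (Set.image_mono fun q hq => of_mem_quotientLetters_left _ hq)
        (hm.1 j n d x)
  have hMu : ∀ j n i d x, M j n i d x ∈ convexHull ℝ (d '' Set.univ) := fun j n i d x =>
    convexHull_mono (Set.image_mono (Set.subset_univ _)) (hMT j n i d x)
  have hN : ∀ ε > (0 : ℝ), ∀ᶠ j : ℕ in atTop, 4 / ((j + 1 : ℕ) : ℝ) ≤ ε := by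
    intro ε hε
    have h := ((tendsto_one_div_add_atTop_nhds_zero_nat (𝕜 := ℝ)).const_mul 4).eventually
      (ge_mem_nhds (by simpa using hε))
    filter_upwards [h] with j hj
    push_cast
    rwa [mul_one_div] at hj
  refine ⟨fun j n d w => ?_, fun γ => ?_⟩
  · refine convexHull_mono ?_ (meanWalk_mem_convexHull (one_mem_quotientLetters (S j) (T j) n)
      (hC01 j n) (hCT j n) (hMT j n) j.succ_ne_zero _ _)
    rintro _ ⟨g, hg, rfl⟩
    obtain ⟨g, rfl⟩ := (coprodEquiv (P n) (Q n)).surjective g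
    exact ⟨g, mem_image_letters_pow hg, by simp⟩
  · induction γ using Coprod.induction_on with
    | inl a =>
      intro ε hε
      -- The estimate `3 * (ε / 6) + 4 / (j + 1)` splits into two halves of `ε`; the number of steps
      -- grows with `j`.
      filter_upwards [hm.2 a (ε / 6) (by positivity), hc.2.2.2 a (ε / 6) (by positivity),
        hN (ε / 2) (by positivity)] with j hj1 hj2 hj3 n d hd w
      rw [Coprod.map_apply_inl, map_mul, coprodEquiv_inl]
      refine (norm_meanWalk_of_mul_sub_le (hC1 j n) (hC01 j n) (hMu j n) (fun g => hd _) ⟨true⟩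
        (α n a) (hj2 n) (hj1 n) j.succ_ne_zero _).trans ?_
      linarith
    | inr a =>
      intro ε hε
      filter_upwards [hk.2 a (ε / 6) (by positivity), hb.2.2.2 a (ε / 6) (by positivity),
        hN (ε / 2) (by positivity)] with j hj1 hj2 hj3 n d hd w
      rw [Coprod.map_apply_inr, map_mul, coprodEquiv_inr]
      refine (norm_meanWalk_of_mul_sub_le (hC1 j n) (hC01 j n) (hMu j n) (fun g => hd _) ⟨false⟩
        (β n a) (hj2 n) (hj1 n) j.succ_ne_zero _).trans ?_
      linarith
    | mul γ δ hγ hδ =>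
      intro ε hε
      filter_upwards [hγ (ε / 2) (by positivity), hδ (ε / 2) (by positivity)]
        with j hj1 hj2 n d hd w
      rw [map_mul (Coprod.map (α n) (β n)), mul_assoc]
      refine (norm_sub_le_norm_sub_add_norm_sub _ _ _).trans
        ((add_le_add (hj1 n d hd _) (hj2 n d hd w)).trans (add_halves ε).le)

end FreeProducts

/-! ### The theorem for free products. -/

theorem mainTheorem5 {A B : Type u} [Group A] [Group B] [Group.FG A] [Group.FG B]
    [Group.ResiduallyFinite A] [Group.ResiduallyFinite B]
    (N : ℕ → Subgroup A) (M : ℕ → Subgroup B)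
    [∀ n, (N n).Normal] [∀ n, (M n).Normal] [∀ n, (N n).FiniteIndex] [∀ n, (M n).FiniteIndex]
    (hN : IsFaithfulSeq N) (hM : IsFaithfulSeq M)
    (ℓA : ProperLength A) (ℓB : ProperLength B) (ℓ : ProperLength (Monoid.Coprod A B))
    (XA XB XG : Type u) [MetricSpace XA] [MetricSpace XB] [MetricSpace XG]
    (hXA : IsCoarseDisjointUnion (fun n =>
      LengthQuotient ℓA (QuotientGroup.mk' (N n)) (QuotientGroup.mk'_surjective (N n))) XA)
    (hXB : IsCoarseDisjointUnion (fun n =>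
      LengthQuotient ℓB (QuotientGroup.mk' (M n)) (QuotientGroup.mk'_surjective (M n))) XB)
    (hXG : IsCoarseDisjointUnion (fun n =>
      LengthQuotient ℓ (freeProductQuotientMap (N n) (M n))
        (freeProductQuotientMap_surjective (N n) (M n))) XG) :
    (CoarselyEmbedsIntoHilbert XA → CoarselyEmbedsIntoHilbert XB →
      CoarselyEmbedsIntoHilbert XG) ∧
    (HasPropertyA XA → HasPropertyA XB → HasPropertyA XG) := by
  refine ⟨fun hA hB => ?_, fun hA hB => ?_⟩
  · obtain ⟨HA, _, _, _, F, hF1, hF2, hFs⟩ := hA.exists_separated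
    obtain ⟨HB, _, _, _, G, hG1, hG2, hGs⟩ := hB.exists_separated
    -- `wordMap` needs one target for both factors; the inclusions into the orthogonal sum are
    -- isometric.
    set F' : XA → WithLp 2 (HA × HB) := fun x => WithLp.toLp 2 (F x, 0)
    set G' : XB → WithLp 2 (HA × HB) := fun x => WithLp.toLp 2 (0, G x)
    have hFn : ∀ x y, ‖F' x - F' y‖ = ‖F x - F y‖ := fun x y =>
      le_antisymm ((norm_toLp_sub_le _ _ _ _).trans (by simp)) (norm_fst_sub_le _ _ _ _)
    have hGn : ∀ x y, ‖G' x - G' y‖ = ‖G x - G y‖ := fun x y =>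
      le_antisymm ((norm_toLp_sub_le _ _ _ _).trans (by simp)) (norm_snd_sub_le _ _ _ _)
    simp only [← hFn] at hF1 hF2 hFs
    simp only [← hGn] at hG1 hG2 hGs
    obtain ⟨f, hf, hf1, hfs⟩ := exists_uniformlyCoarse hXA hF1 hF2 hFs
    obtain ⟨g, hg, hg1, hgs⟩ := exists_uniformlyCoarse hXB hG1 hG2 hGs
    exact (hf.coprod hg hf1 hg1 hfs hgs).coarselyEmbedsIntoHilbert hXG
  · have : ∀ n, Nonempty (LengthQuotient ℓ (freeProductQuotientMap (N n) (M n))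
      (freeProductQuotientMap_surjective (N n) (M n))) := fun n => ⟨toLengthQuotient _ _ _ 1⟩
    -- The operators act on functions with values in `ℓ¹` of the final space, so that they can be
    -- applied to its point masses.
    obtain ⟨S, m, c, hS, hm, hc⟩ := exists_uniformlyAveraging hXA hA (lp (fun _ : XG => ℝ) 1)
    obtain ⟨T, k, b, hT, hk, hb⟩ := exists_uniformlyAveraging hXB hB (lp (fun _ : XG => ℝ) 1)
    refine hXG.hasPropertyA (LengthQuotient.uniformly_boundedGeometry ℓ
      (fun n => freeProductQuotientMap (N n) (M n)) _) ?_
    exact (hm.coprod hk hc hb).hasAveraging fun j => finite_letters_pow (hS j) (hT j) _
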